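/- **Theorem 2.2.** Let $N\ge p\ge 2$ be integers, $\kappa>0$, $V:\mathbb R^d\to\mathbb R$, $K:\mathbb R^d\to\mathbb R^d$, and let $X_0^1,\dots,X_0^N$ be random vectors in $\mathbb R^d$. Without diffusion ($\sigma=0$), the interacting particle system (IPS) is the solution of $$dX^i=-\nabla V(X^i)\,dt+\frac1{N-1}\sum_{j\ne i}K(X^j-X^i)\,dt,\qquad X^i(0)=X_0^i,\quad 1\le i\le N,$$ and the Random Batch Method with replacement (RBM-r) is the continuous process $\tilde X=(\tilde X^i)_{i\le N}$ with $\tilde X^i(0)=X_0^i$ such that, for every $k\ge 0$ and $t\in[k\kappa,(k+1)\kappa)$, $$d\tilde X^i=-\nabla V(\tilde X^i)\,dt+\frac1{p-1}\sum_{j\in\mathcal C_k,\,j\ne i}K(\tilde X^j-\tilde X^i)\,dt\ \ (i\in\mathcal C_k),\qquad d\tilde X^i=0\ \ (i\notin\mathcal C_k),$$ where $\mathcal C_0,\mathcal C_1,\dots$ are independent, uniformly distributed $p$-element subsets of $\{1,\dots,N\}$, the whole sequence being independent of $(X_0^i)_i$. Assume that 1. $V$ is differentiable, $x\mapsto V(x)-\frac\lambda2|x|^2$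 is convex, and $|\nabla V(x)|\le A(1+|x|^q)$ for some $q>0$; 2. $|K|\le B$ and $K$ is Lipschitz with constant $L$; 3. $\lambda>2L$; 4. $\mathbb E|X_0^i|^{2q}\le M$ for all $i$. Then there is a constant $C>0$, depending only on $d,\lambda,L,B,A,q,M$ (in particular independent of $T$, $N$, $p$ and $\kappa$), such that for all $T>0$ and all $N\ge p\ge 2$ there is $\kappa_0>0$ such that for all $0<\kappa<\kappa_0$ and every $i$, $$\sup_{0\le t\le T}W_2\bigl(\tilde\rho^{(i)}_{\frac Npt},\rho^{(i)}_t\bigr)\le C\sqrt{1+T}\,\Bigl(\frac Np\Bigr)^{3/4}\kappa^{1/2},$$ where $\rho^{(i)}_t$ and $\tilde\rho^{(i)}_t$ are the laws of $X^i(t)$ and $\tilde X^i(t)$, and $W_2(\mu,\nu)=\bigl(\inf_{\gamma}\int|x-y|^2\,d\gamma\bigr)^{1/2}$, the infimum being over all couplings $\gamma$ of $\mu$ and $\nu$. In particular ($i=1$) this holds for the first marginals. -/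

import Mathlib

open MeasureTheory ProbabilityTheory
open scoped ENNReal NNReal Gradient

noncomputable section

/-- The state space `ℝ^d` with its Euclidean norm. -/
abbrev RBM.E (d : ℕ) : Type := EuclideanSpace ℝ (Fin d)

/-- The Wasserstein-2 distance of two measures, with values in `[0, ∞]`: the square root of the
infimum of `∫ |x - y|² dγ` over all couplings `γ` of `μ` and `ν`. -/
def RBM.W2 {d : ℕ} (μ ν : Measure (RBM.E d)) : ℝ≥0∞ :=
  (⨅ γ ∈ {γ : Measure (RBM.E d × RBM.E d) | γ.map Prod.fst = μ ∧ γ.map Prod.snd = ν},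
    ∫⁻ z, edist z.1 z.2 ^ 2 ∂γ) ^ (1 / 2 : ℝ)

/-- The assumptions on the confining potential `V` and the interaction kernel `K`: `V` is
differentiable and `lam`-strongly convex, its gradient grows polynomially (constant `A`,
exponent `q`), and `K` is bounded by `B` and Lipschitz with constant `L`, where `lam > 2 L`. -/
structure RBM.Admissible {d : ℕ} (lam : ℝ) (L : ℝ≥0) (B A q : ℝ)
    (V : RBM.E d → ℝ) (K : RBM.E d → RBM.E d) : Prop where
  differentiable : Differentiable ℝ V
  strongConvex : ConvexOn ℝ Set.univ (fun x => V x - lam / 2 * ‖x‖ ^ 2)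
  growth : ∀ x, ‖∇ V x‖ ≤ A * (1 + ‖x‖ ^ q)
  bounded : ∀ x, ‖K x‖ ≤ B
  lipschitz : LipschitzWith L K
  lam_gt : 2 * (L : ℝ) < lam

/-- Velocity of particle `i` in the full interacting particle system of `N` particles. -/
def RBM.ipsDrift {d N : ℕ} (V : RBM.E d → ℝ) (K : RBM.E d → RBM.E d)
    (x : Fin N → RBM.E d) (i : Fin N) : RBM.E d :=
  -∇ V (x i) + (1 / ((N : ℝ) - 1)) • ∑ j ∈ Finset.univ.erase i, K (x j - x i)

/-- Velocity of particle `i` while the batch `S` of size `p` is active: the particles of the batch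
interact among themselves, all the others are frozen. -/
def RBM.batchDrift {d N : ℕ} (V : RBM.E d → ℝ) (K : RBM.E d → RBM.E d) (p : ℕ)
    (S : Finset (Fin N)) (x : Fin N → RBM.E d) (i : Fin N) : RBM.E d :=
  if i ∈ S then
    -∇ V (x i) + (1 / ((p : ℝ) - 1)) • ∑ j ∈ S.erase i, K (x j - x i)
  else 0

/-- `X` is the interacting particle system without diffusion (`σ = 0`) started from `X₀`: a process
indexed by `t ≥ 0` whose paths almost surely are continuous and solve the system of ODEs
`dX^i = -∇V(X^i) dt + (N-1)⁻¹ ∑_{j ≠ i} K(X^j - X^i) dt`, in the sense of right derivatives. -/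
structure RBM.IsIPS {d N : ℕ} {Ω : Type*} [MeasurableSpace Ω] (P : Measure Ω)
    (V : RBM.E d → ℝ) (K : RBM.E d → RBM.E d) (X₀ : Fin N → Ω → RBM.E d)
    (X : Fin N → ℝ → Ω → RBM.E d) : Prop where
  measurable : ∀ i, ∀ t ≥ 0, Measurable (X i t)
  init : ∀ᵐ ω ∂P, ∀ i, X i 0 ω = X₀ i ω
  continuous : ∀ᵐ ω ∂P, ∀ i, ContinuousOn (fun t => X i t ω) (Set.Ici 0)
  ode : ∀ᵐ ω ∂P, ∀ i, ∀ t ≥ 0, HasDerivWithinAt (fun s => X i s ω)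
    (RBM.ipsDrift V K (fun j => X j t ω) i) (Set.Ici t) t

/-- `𝒞 0, 𝒞 1, …` are independent uniformly distributed `p`-element subsets of the `N` particle
labels, and the whole sequence is independent of the initial configuration `X₀`. -/
structure RBM.IsBatchSequence {d N : ℕ} {Ω : Type*} [MeasurableSpace Ω] (P : Measure Ω) (p : ℕ)
    (X₀ : Fin N → Ω → RBM.E d) (𝒞 : ℕ → Ω → Finset (Fin N)) : Prop where
  measurable : ∀ k, Measurable (𝒞 k)
  uniform : ∀ k, ∀ S : Finset (Fin N), S.card = p →
    P {ω | 𝒞 k ω = S} = ((N.choose p : ℕ) : ℝ≥0∞)⁻¹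
  indep : iIndepFun 𝒞 P
  indep_init : IndepFun (fun ω k => 𝒞 k ω) (fun ω i => X₀ i ω) P

/-- `Y` is the random batch method with replacement without diffusion (`σ = 0`), with time step `κ`,
batch size `p` and batches `𝒞`, started from `X₀`: a process indexed by `t ≥ 0` whose paths almost
surely are continuous and on each interval `[k κ, (k + 1) κ)`, that is for `k = ⌊t / κ⌋`, solve the
system of ODEs (in the sense of right derivatives) in which batch `𝒞 k` is active. -/
structure RBM.IsRBMr {d N : ℕ} {Ω : Type*} [MeasurableSpace Ω] (P : Measure Ω)
    (V : RBM.E d → ℝ) (K : RBM.E d → RBM.E d) (p : ℕ) (κ : ℝ)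
    (X₀ : Fin N → Ω → RBM.E d) (𝒞 : ℕ → Ω → Finset (Fin N))
    (Y : Fin N → ℝ → Ω → RBM.E d) : Prop where
  measurable : ∀ i, ∀ t ≥ 0, Measurable (Y i t)
  init : ∀ᵐ ω ∂P, ∀ i, Y i 0 ω = X₀ i ω
  continuous : ∀ᵐ ω ∂P, ∀ i, ContinuousOn (fun t => Y i t ω) (Set.Ici 0)
  ode : ∀ᵐ ω ∂P, ∀ i, ∀ t ≥ 0, HasDerivWithinAt (fun s => Y i s ω)
    (RBM.batchDrift V K p (𝒞 ⌊t / κ⌋₊ ω) (fun j => Y j t ω) i) (Set.Ici t) t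

end

/-! In a batch step a given particle is active with probability `p / N`, so the random batch
dynamics should follow the full system run at speed `θ = p / N`. Both processes live on one
probability space with the same initial data, and any such coupling bounds `W2` (`W2_map_le`). It
remains to bound the mean square of `D_i(s) = Y_i(s) - X_i(θ s)`.

On one time step the velocity of `D_i` is split at `G`, the batch drift evaluated at the full
system. The difference of the batch drifts of the two systems dissipates: strong convexity against
the Lipschitz kernel gives rate `2λ - 3L` in `D_i` and returns at most `L` times a weighted mean of
the `‖D_j‖²` (`two_inner_drift_sub_le`). The consistency error `G - θ w`, with `θ w` the velocity of
the slowed full system, is a multiple of that velocity with centred random factor plus a sum of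
kernels with centred random weights. Freezing `D_i` and the kernels at the start of the step costs
`O(κ²)`. The velocity is not frozen but integrated to the increment of the full system; hence no
modulus of continuity of `∇V` is needed, only a priori bounds (`Admissible.sq_norm_sub_step_le`).

This increment is determined by the initial data, and the state at the start of the step by the
initial data and the earlier batches. The current batch is independent of both (`indepFun_state`),
so the two centred terms have mean zero. With a bound `U` common to all particles, the recursion is
`u ↦ (1 - κ(2λ - 3L)θ) u + κ L θ U + O(κ²)` (`integral_sq_norm_sub_step_le`). As `λ > 2L`, it
preserves a bound of order `κ N / p`, uniformly in the number of steps (`integral_sq_norm_sub_le`).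
Hence `W2` is of order `(N / p)^(1/2) κ^(1/2)`, uniformly in time, which is stronger than the claim.
-/

namespace RBM

/-! ### Consequences of admissibility -/

section Potential

variable {d : ℕ} {lam : ℝ} {L : ℝ≥0} {B A q : ℝ} {V : E d → ℝ} {K : E d → E d}

/-- Along the segment from `y` to `x` the function `V - λ/2 ‖·‖²` is convex in one variable, so its
derivative at `1` dominates the one at `0`. -/
theorem Admissible.strongly_monotone (h : Admissible lam L B A q V K) (x y : E d) :
    lam * ‖x - y‖ ^ 2 ≤ inner ℝ (x - y) (∇ V x - ∇ V y) := by
  set v := x - y with hv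
  set g : ℝ → ℝ := fun t => V (y + t • v) - lam / 2 * ‖y + t • v‖ ^ 2 with hg
  have hconv : ConvexOn ℝ Set.univ g := by
    have := h.strongConvex.comp_affineMap (AffineMap.lineMap y x)
    simp only [Set.preimage_univ] at this
    have e : g = (fun x => V x - lam / 2 * ‖x‖ ^ 2) ∘ AffineMap.lineMap (k := ℝ) y x := by
      ext t
      simp [hg, AffineMap.lineMap_apply, hv, add_comm]
    rw [e]
    exact this
  have hder : ∀ t, HasDerivAt g
      (inner ℝ v (∇ V (y + t • v)) - lam * inner ℝ v (y + t • v)) t := by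
    intro t
    have hline : HasDerivAt (fun t : ℝ => y + t • v) v t := by
      simpa using ((hasDerivAt_id t).smul_const v).const_add y
    have h1 : HasDerivAt (fun t : ℝ => V (y + t • v)) (inner ℝ v (∇ V (y + t • v))) t := by
      have := (h.differentiable (y + t • v)).hasFDerivAt.comp_hasDerivAt t hline
      rw [← inner_gradient_left, real_inner_comm] at this
      exact this
    have h2 := (hline.norm_sq).const_mul (lam / 2)
    refine (h1.sub h2).congr_deriv ?_
    rw [real_inner_comm v (y + t • v)]
    ring
  have hmono : deriv g 0 ≤ deriv g 1 :=
    hconv.monotoneOn_deriv (fun t _ => (hder t).differentiableAt) (Set.mem_univ _)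
      (Set.mem_univ _) zero_le_one
  rw [(hder 0).deriv, (hder 1).deriv] at hmono
  have hx : y + (1 : ℝ) • v = x := by simp [hv]
  rw [hx, zero_smul, add_zero] at hmono
  rw [inner_sub_right, ← real_inner_self_eq_norm_sq]
  have : inner ℝ v v = inner ℝ v x - inner ℝ v y := by rw [← inner_sub_right]
  rw [this]
  linarith

theorem Admissible.lam_pos (h : Admissible lam L B A q V K) : 0 < lam :=
  lt_of_le_of_lt (by positivity) h.lam_gt

theorem Admissible.norm_gradient_zero_le (h : Admissible lam L B A q V K) (hq : 0 < q) :
    ‖∇ V 0‖ ≤ A := by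
  simpa [Real.zero_rpow hq.ne'] using h.growth 0

theorem Admissible.A_nonneg (h : Admissible lam L B A q V K) (hq : 0 < q) : 0 ≤ A :=
  (norm_nonneg _).trans (h.norm_gradient_zero_le hq)

theorem Admissible.B_nonneg (h : Admissible lam L B A q V K) : 0 ≤ B :=
  (norm_nonneg _).trans (h.bounded 0)

theorem Admissible.inner_neg_gradient_le (h : Admissible lam L B A q V K) (hq : 0 < q)
    (x : E d) : inner ℝ x (-∇ V x) ≤ ‖x‖ * (A - lam * ‖x‖) := by
  have h1 := h.strongly_monotone x 0
  rw [sub_zero, inner_sub_right] at h1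
  have h2 := neg_le_of_abs_le (abs_real_inner_le_norm x (∇ V 0))
  have h3 := mul_le_mul_of_nonneg_left (h.norm_gradient_zero_le hq) (norm_nonneg x)
  rw [inner_neg_right]
  nlinarith

/-- Strong convexity makes `‖∇V‖` grow at least linearly, and the growth condition caps it by `‖x‖ ^
q`. Thus `‖x‖` itself is controlled by `‖x‖ ^ q`, and the moment of order `2q` suffices for second
moments of positions as well as of velocities. -/
theorem Admissible.lam_mul_norm_le (h : Admissible lam L B A q V K) (hq : 0 < q)
    (x : E d) : lam * ‖x‖ ≤ 2 * A + A * ‖x‖ ^ q := by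
  have hA := h.A_nonneg hq
  rcases (norm_nonneg x).eq_or_lt with h0 | h0
  · rw [← h0, Real.zero_rpow hq.ne']
    linarith
  · have h1 := h.inner_neg_gradient_le hq x
    have h2 := real_inner_le_norm x (∇ V x)
    rw [inner_neg_right] at h1
    have h3 := h.growth x
    have h4 : ‖x‖ * (lam * ‖x‖ - A) ≤ ‖x‖ * (A * (1 + ‖x‖ ^ q)) := by
      nlinarith [mul_le_mul_of_nonneg_left h3 h0.le]
    have := le_of_mul_le_mul_left h4 h0
    linarith

end Potential

/-! ### Drifts as weighted sums -/

section Weights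

variable {d N : ℕ}

/-- The indicator of particle `i` being in the batch `S`. -/
noncomputable def activity (S : Finset (Fin N)) (i : Fin N) : ℝ := if i ∈ S then 1 else 0

/-- The weight with which particle `j` acts on particle `i` while batch `S` is active. -/
noncomputable def batchWeight (p : ℕ) (S : Finset (Fin N)) (i j : Fin N) : ℝ :=
  if i ∈ S ∧ j ∈ S ∧ j ≠ i then 1 / ((p : ℝ) - 1) else 0

theorem activity_nonneg (S : Finset (Fin N)) (i : Fin N) : 0 ≤ activity S i := by
  unfold activity; split_ifs <;> norm_num

theorem activity_le_one (S : Finset (Fin N)) (i : Fin N) : activity S i ≤ 1 := by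
  unfold activity; split_ifs <;> norm_num

theorem batchWeight_nonneg {p : ℕ} (hp : 2 ≤ p) (S : Finset (Fin N)) (i j : Fin N) :
    0 ≤ batchWeight p S i j := by
  have : (2 : ℝ) ≤ p := by exact_mod_cast hp
  unfold batchWeight; split_ifs
  · apply one_div_nonneg.2; linarith
  · exact le_rfl

theorem sum_batchWeight_smul {F : Type*} [AddCommGroup F] [Module ℝ F] (p : ℕ)
    {S : Finset (Fin N)} {i : Fin N} (hi : i ∈ S) (f : Fin N → F) :
    ∑ j, batchWeight p S i j • f j = (1 / ((p : ℝ) - 1)) • ∑ j ∈ S.erase i, f j := by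
  rw [Finset.smul_sum]
  have : S.erase i = Finset.univ.filter (fun j => i ∈ S ∧ j ∈ S ∧ j ≠ i) := by
    ext j; simp [hi, and_comm]
  rw [this, Finset.sum_filter]
  refine Finset.sum_congr rfl fun j _ => ?_
  unfold batchWeight; split_ifs <;> simp

theorem sum_batchWeight {p : ℕ} (hp : 2 ≤ p) {S : Finset (Fin N)} (hS : S.card = p)
    (i : Fin N) : ∑ j, batchWeight p S i j = activity S i := by
  have hp' : (2 : ℝ) ≤ p := by exact_mod_cast hp
  by_cases hi : i ∈ S
  · have := sum_batchWeight_smul p hi (fun _ => (1 : ℝ))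
    simp only [smul_eq_mul, mul_one, Finset.sum_const, nsmul_eq_mul] at this
    rw [this, Finset.card_erase_of_mem hi, hS, Nat.cast_sub (by lia), activity, if_pos hi]
    push_cast
    exact one_div_mul_cancel (by linarith)
  · simp [activity, batchWeight, hi]

theorem batchDrift_eq (V : E d → ℝ) (K : E d → E d) (p : ℕ) (S : Finset (Fin N))
    (x : Fin N → E d) (i : Fin N) :
    batchDrift V K p S x i =
      activity S i • (-∇ V (x i)) + ∑ j, batchWeight p S i j • K (x j - x i) := by
  unfold batchDrift
  split_ifs with hi
  · rw [sum_batchWeight_smul p hi]; simp [activity, hi]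
  · simp [activity, batchWeight, hi]

/-- The full system is the batch dynamics whose batch is always everything, so each estimate on
batch paths serves both processes. -/
theorem ipsDrift_eq_batchDrift (V : E d → ℝ) (K : E d → E d) (x : Fin N → E d) (i : Fin N) :
    ipsDrift V K x i = batchDrift V K N Finset.univ x i := by
  simp [ipsDrift, batchDrift]

end Weights

/-! ### Pointwise estimates for weighted drifts -/

section Drift

variable {d N : ℕ} {lam : ℝ} {L : ℝ≥0} {B A q : ℝ} {V : E d → ℝ} {K : E d → E d}

theorem Admissible.norm_sum_smul_le (h : Admissible lam L B A q V K) {a : Fin N → ℝ}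
    (ha : ∀ j, 0 ≤ a j) (x : Fin N → E d) (i : Fin N) :
    ‖∑ j, a j • K (x j - x i)‖ ≤ (∑ j, a j) * B := by
  rw [Finset.sum_mul]
  refine norm_sum_le_of_le _ fun j _ => ?_
  rw [norm_smul, Real.norm_of_nonneg (ha j)]
  exact mul_le_mul_of_nonneg_left (h.bounded _) (ha j)

theorem Admissible.norm_kernel_sub_le (h : Admissible lam L B A q V K) (y z : Fin N → E d)
    (i j : Fin N) : ‖K (y j - y i) - K (z j - z i)‖ ≤ L * (‖y i - z i‖ + ‖y j - z j‖) := by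
  have h1 := h.lipschitz.dist_le_mul (y j - y i) (z j - z i)
  rw [dist_eq_norm, dist_eq_norm] at h1
  refine h1.trans (mul_le_mul_of_nonneg_left ?_ L.coe_nonneg)
  have : y j - y i - (z j - z i) = (y j - z j) - (y i - z i) := by abel
  rw [this, add_comm]
  exact norm_sub_le _ _

/-- One-sided Lipschitz estimate for a weighted drift. -/
theorem Admissible.two_inner_drift_sub_le (h : Admissible lam L B A q V K) {a : Fin N → ℝ}
    (ha : ∀ j, 0 ≤ a j) (y z : Fin N → E d) (i : Fin N) :
    2 * inner ℝ (y i - z i)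
        (((∑ j, a j) • (-∇ V (y i)) + ∑ j, a j • K (y j - y i)) -
          ((∑ j, a j) • (-∇ V (z i)) + ∑ j, a j • K (z j - z i))) ≤
      -(2 * lam - 3 * L) * (∑ j, a j) * ‖y i - z i‖ ^ 2 + L * ∑ j, a j * ‖y j - z j‖ ^ 2 := by
  have hι : 0 ≤ ∑ j, a j := Finset.sum_nonneg fun j _ => ha j
  have e : ((∑ j, a j) • (-∇ V (y i)) + ∑ j, a j • K (y j - y i)) -
      ((∑ j, a j) • (-∇ V (z i)) + ∑ j, a j • K (z j - z i)) =
      -((∑ j, a j) • (∇ V (y i) - ∇ V (z i))) +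
        ∑ j, a j • (K (y j - y i) - K (z j - z i)) := by
    simp only [smul_sub, smul_neg, Finset.sum_sub_distrib]
    abel
  rw [e, inner_add_right, inner_neg_right, inner_smul_right, inner_sum]
  have h1 := mul_le_mul_of_nonneg_left (h.strongly_monotone (y i) (z i)) hι
  have h2 : ∑ j, inner ℝ (y i - z i) (a j • (K (y j - y i) - K (z j - z i))) ≤
      ∑ j, (a j * (L * 3 / 2 * ‖y i - z i‖ ^ 2) + L / 2 * (a j * ‖y j - z j‖ ^ 2)) := by
    refine Finset.sum_le_sum fun j _ => ?_
    rw [inner_smul_right]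
    have h3 := (real_inner_le_norm (y i - z i) (K (y j - y i) - K (z j - z i))).trans
      (mul_le_mul_of_nonneg_left (h.norm_kernel_sub_le y z i j) (norm_nonneg _))
    -- Young's inequality on the mixed product: after doubling, `3L` falls on particle `i` and `L`
    -- on particle `j`, whence the threshold `2λ > 4L`.
    have h4 : ‖y i - z i‖ * (L * (‖y i - z i‖ + ‖y j - z j‖)) ≤
        L * 3 / 2 * ‖y i - z i‖ ^ 2 + L / 2 * ‖y j - z j‖ ^ 2 := by
      nlinarith [mul_nonneg L.coe_nonneg (sq_nonneg (‖y i - z i‖ - ‖y j - z j‖))]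
    have := mul_le_mul_of_nonneg_left (h3.trans h4) (ha j)
    linarith
  rw [Finset.sum_add_distrib, ← Finset.sum_mul, ← Finset.mul_sum] at h2
  linarith

end Drift

end RBM

namespace RBM

/-! ### Pathwise estimates -/

section Pathwise

variable {d N : ℕ} {lam : ℝ} {L : ℝ≥0} {B A q : ℝ} {V : E d → ℝ} {K : E d → E d}

/-- A particle driven by `-∇V` and a bounded force, at a variable rate, stays bounded. -/
theorem Admissible.norm_le_of_hasDerivWithinAt (h : Admissible lam L B A q V K) (hq : 0 < q)
    {f k : ℝ → E d} {ι : ℝ → ℝ} (hι : ∀ t, 0 ≤ ι t) (hk : ∀ t, ‖k t‖ ≤ ι t * B)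
    (hf : ContinuousOn f (Set.Ici 0))
    (hf' : ∀ t ≥ 0, HasDerivWithinAt f (ι t • (-∇ V (f t)) + k t) (Set.Ici t) t)
    {t : ℝ} (ht : 0 ≤ t) : ‖f t‖ ≤ ‖f 0‖ + (A + B) / lam := by
  have hlam := h.lam_pos
  have hρ : 0 ≤ (A + B) / lam := div_nonneg (add_nonneg (h.A_nonneg hq) h.B_nonneg) hlam.le
  set R := ‖f 0‖ + (A + B) / lam with hR
  have hR0 : 0 ≤ R := add_nonneg (norm_nonneg _) hρ
  refine le_of_sq_le_sq ?_ hR0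
  refine le_of_forall_pos_le_add fun ε hε => ?_
  have ht1 : (0 : ℝ) < t + 1 := by linarith
  -- On the sphere of radius `R` the radial velocity may vanish, while the comparison principle
  -- wants a strict inequality; the barrier is therefore tilted by a slope that adds at most `ε` up
  -- to time `t`.
  have key := image_le_of_deriv_right_lt_deriv_boundary (f := fun s => ‖f s‖ ^ 2)
    (f' := fun s => 2 * inner ℝ (f s) (ι s • (-∇ V (f s)) + k s)) (a := 0) (b := t)
    (B := fun s => R ^ 2 + ε / (t + 1) * s) (B' := fun _ => ε / (t + 1))
    ((hf.mono Set.Icc_subset_Ici_self).norm.pow 2)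
    (fun s hs => (hf' s hs.1).norm_sq) ?_ ?_ ?_ (Set.right_mem_Icc.2 ht)
  · refine key.trans ?_
    have : ε / (t + 1) * t ≤ ε := by
      rw [div_mul_eq_mul_div, div_le_iff₀ ht1]; nlinarith
    linarith
  · simp only [mul_zero, add_zero]
    exact pow_le_pow_left₀ (norm_nonneg _) (by linarith) 2
  · intro s
    simpa using ((hasDerivAt_id s).const_mul (ε / (t + 1))).const_add (R ^ 2)
  · intro s hs heq
    have hε' : 0 < ε / (t + 1) := div_pos hε ht1
    have hge : R ≤ ‖f s‖ := by
      refine le_of_sq_le_sq ?_ (norm_nonneg _)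
      rw [heq]
      have := mul_nonneg hε'.le hs.1
      linarith
    refine lt_of_le_of_lt ?_ hε'
    rw [inner_add_right, inner_smul_right]
    have h1 := mul_le_mul_of_nonneg_left (h.inner_neg_gradient_le hq (f s)) (hι s)
    have h2 := (real_inner_le_norm (f s) (k s)).trans
      (mul_le_mul_of_nonneg_left (hk s) (norm_nonneg _))
    have h3 : A + B ≤ lam * ‖f s‖ := by
      have : (A + B) / lam ≤ ‖f s‖ := by
        refine le_trans ?_ hge
        rw [hR]; linarith [norm_nonneg (f 0)]
      rw [div_le_iff₀ hlam] at this
      linarith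
    have h4 : 0 ≤ ι s * ‖f s‖ * (lam * ‖f s‖ - (A + B)) :=
      mul_nonneg (mul_nonneg (hι s) (norm_nonneg _)) (by linarith)
    nlinarith

theorem sq_norm_le_of_norm_sub_le {u v : E d} {c g : ℝ} (hu : ‖u‖ ≤ 2 * g) (hv : ‖v‖ ≤ 2 * g)
    (huv : ‖u - v‖ ≤ 2 * (c * g)) : |‖u‖ ^ 2 - ‖v‖ ^ 2| ≤ 8 * c * g ^ 2 := by
  have h1 : |‖u‖ - ‖v‖| ≤ 2 * (c * g) := (abs_norm_sub_norm_le u v).trans huv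
  have h2 : ‖u‖ ^ 2 - ‖v‖ ^ 2 = (‖u‖ - ‖v‖) * (‖u‖ + ‖v‖) := by ring
  rw [h2, abs_mul, abs_of_nonneg (add_nonneg (norm_nonneg u) (norm_nonneg v))]
  have h3 : ‖u‖ + ‖v‖ ≤ 4 * g := by linarith
  calc _ ≤ 2 * (c * g) * (4 * g) :=
        mul_le_mul h1 h3 (by positivity) ((abs_nonneg _).trans h1)
    _ = 8 * c * g ^ 2 := by ring

/-- Comparison for the squared distance of two paths, corrected by a term linear in the increment of
the second path and in time. -/
theorem sq_norm_sub_le_of_deriv_le {y z y' z' : ℝ → E d} {k₀ : E d} {t₀ κ c β : ℝ} (hκ : 0 ≤ κ)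
    (hyc : ContinuousOn y (Set.Icc t₀ (t₀ + κ))) (hzc : ContinuousOn z (Set.Icc t₀ (t₀ + κ)))
    (hy : ∀ s ∈ Set.Ico t₀ (t₀ + κ), HasDerivWithinAt y (y' s) (Set.Ici s) s)
    (hz : ∀ s ∈ Set.Ico t₀ (t₀ + κ), HasDerivWithinAt z (z' s) (Set.Ici s) s)
    (hβ : ∀ s ∈ Set.Ico t₀ (t₀ + κ), 2 * inner ℝ (y s - z s) (y' s - z' s) -
      2 * inner ℝ (y t₀ - z t₀) (c • z' s + k₀) ≤ β) :
    ‖y (t₀ + κ) - z (t₀ + κ)‖ ^ 2 ≤ ‖y t₀ - z t₀‖ ^ 2 +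
      2 * inner ℝ (y t₀ - z t₀) (c • (z (t₀ + κ) - z t₀)) +
      2 * κ * inner ℝ (y t₀ - z t₀) k₀ + κ * β := by
  set D₀ := y t₀ - z t₀ with hD₀
  have hlin : ∀ s ∈ Set.Ico t₀ (t₀ + κ), HasDerivWithinAt
      (fun s => c • (z s - z t₀) + (s - t₀) • k₀) (c • z' s + k₀) (Set.Ici s) s := by
    intro s hs
    have h2 : HasDerivAt (fun s : ℝ => (s - t₀) • k₀) k₀ s := by
      simpa using ((hasDerivAt_id s).sub_const t₀).smul_const k₀
    exact (((hz s hs).sub_const (z t₀)).fun_const_smul c).fun_add h2.hasDerivWithinAt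
  have hc : ContinuousOn (fun s => ‖y s - z s‖ ^ 2 -
      2 * inner ℝ D₀ (c • (z s - z t₀) + (s - t₀) • k₀)) (Set.Icc t₀ (t₀ + κ)) := by
    have h1 : ContinuousOn (fun s => c • (z s - z t₀) + (s - t₀) • k₀)
        (Set.Icc t₀ (t₀ + κ)) :=
      ((hzc.sub continuousOn_const).const_smul c).add
        (Continuous.continuousOn (by fun_prop))
    exact ((hyc.sub hzc).norm.pow 2).sub
      (continuousOn_const.mul (continuousOn_const.inner h1))
  -- The corrector is differentiated together with the squared distance, so that the contribution of
  -- `z'` integrates exactly to an increment of `z`.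
  have key := image_le_of_deriv_right_le_deriv_boundary
    (f := fun s => ‖y s - z s‖ ^ 2 - 2 * inner ℝ D₀ (c • (z s - z t₀) + (s - t₀) • k₀))
    (f' := fun s => 2 * inner ℝ (y s - z s) (y' s - z' s) -
        2 * inner ℝ D₀ (c • z' s + k₀)) (a := t₀) (b := t₀ + κ)
    (B := fun s => ‖D₀‖ ^ 2 + β * (s - t₀)) (B' := fun _ => β)
    hc (fun s hs => ?_) (by simp [hD₀]) (Continuous.continuousOn (by fun_prop))
    (fun s _ => ?_) hβ (Set.right_mem_Icc.2 (by linarith))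
  · simp only [inner_add_right, inner_smul_right, add_sub_cancel_left] at key
    simp only [inner_smul_right]
    linarith
  · refine ((hy s hs).fun_sub (hz s hs)).norm_sq.fun_sub (HasDerivWithinAt.const_mul 2 ?_)
    simpa using (hasDerivWithinAt_const s (Set.Ici s) D₀).inner ℝ (hlin s hs)
  · simpa using ((((hasDerivAt_id s).sub_const t₀).const_mul β).const_add
      (‖D₀‖ ^ 2)).hasDerivWithinAt

/-- Evolution over a time step `[t₀, t₀ + κ]` of the distance between particle `i` of a system with
interaction weights `a` and particle `i` of a system slowed down by `θ` with weights `b`. -/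
theorem Admissible.sq_norm_sub_step_le (h : Admissible lam L B A q V K) {a b : Fin N → ℝ}
    (ha : ∀ j, 0 ≤ a j) (hb : ∀ j, 0 ≤ b j) (ha1 : ∑ j, a j ≤ 1) (hb1 : ∑ j, b j = 1)
    {θ : ℝ} (hθ : 0 < θ) (hθ1 : θ ≤ 1) {i : Fin N} {y z : Fin N → ℝ → E d} {t₀ κ : ℝ}
    (hκ : 0 ≤ κ) {Γ : Fin N → ℝ}
    (hyc : ContinuousOn (y i) (Set.Icc t₀ (t₀ + κ)))
    (hzc : ContinuousOn (z i) (Set.Icc t₀ (t₀ + κ)))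
    (hy : ∀ s ∈ Set.Ico t₀ (t₀ + κ), HasDerivWithinAt (y i)
      ((∑ j, a j) • (-∇ V (y i s)) + ∑ j, a j • K (y j s - y i s)) (Set.Ici s) s)
    (hz : ∀ s ∈ Set.Ico t₀ (t₀ + κ), HasDerivWithinAt (z i)
      (θ • (-∇ V (z i s) + ∑ j, b j • K (z j s - z i s))) (Set.Ici s) s)
    (hyΓ : ∀ j, ∀ s ∈ Set.Icc t₀ (t₀ + κ), ‖y j s‖ ≤ Γ j)
    (hzΓ : ∀ j, ∀ s ∈ Set.Icc t₀ (t₀ + κ), ‖z j s‖ ≤ Γ j)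
    (hyΔ : ∀ j, ∀ s ∈ Set.Icc t₀ (t₀ + κ), ‖y j s - y j t₀‖ ≤ κ * Γ j)
    (hzΔ : ∀ j, ∀ s ∈ Set.Icc t₀ (t₀ + κ), ‖z j s - z j t₀‖ ≤ κ * Γ j)
    (hV : ∀ s ∈ Set.Icc t₀ (t₀ + κ), ‖∇ V (z i s)‖ + B ≤ Γ i) :
    ‖y i (t₀ + κ) - z i (t₀ + κ)‖ ^ 2 ≤ ‖y i t₀ - z i t₀‖ ^ 2 +
      2 * (((∑ j, a j) / θ - 1) * inner ℝ (y i t₀ - z i t₀) (z i (t₀ + κ) - z i t₀)) +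
      2 * κ * ∑ j, (a j - (∑ j, a j) * b j) *
        inner ℝ (y i t₀ - z i t₀) (K (z j t₀ - z i t₀)) +
      κ * (-(2 * lam - 3 * L) * (∑ j, a j) * ‖y i t₀ - z i t₀‖ ^ 2 +
        L * ∑ j, a j * ‖y j t₀ - z j t₀‖ ^ 2) +
      κ ^ 2 * ((16 * lam - 12 * L + 8) * Γ i ^ 2 + 10 * L * ∑ j, a j * Γ j ^ 2 +
        2 * L * ∑ j, b j * Γ j ^ 2) := by
  have ht₀ : t₀ ∈ Set.Icc t₀ (t₀ + κ) := Set.left_mem_Icc.2 (by linarith)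
  have hL := L.coe_nonneg
  have hgt := h.lam_gt
  set ι := ∑ j, a j with hι
  have hι0 : 0 ≤ ι := Finset.sum_nonneg fun j _ => ha j
  have hΓ : ∀ j, 0 ≤ Γ j := fun j => (norm_nonneg _).trans (hyΓ j t₀ ht₀)
  set D₀ := y i t₀ - z i t₀ with hD₀
  set k₀ : E d := ∑ j, (a j - ι * b j) • K (z j t₀ - z i t₀) with hk₀
  have hk₀' : ∑ j, (a j - ι * b j) * inner ℝ D₀ (K (z j t₀ - z i t₀)) = inner ℝ D₀ k₀ := by
    rw [hk₀, inner_sum]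
    simp only [inner_smul_right]
  rw [hk₀']
  set β := -(2 * lam - 3 * L) * ι * ‖D₀‖ ^ 2 + L * ∑ j, a j * ‖y j t₀ - z j t₀‖ ^ 2 with hβ
  -- Freezing costs: `8(2λ - 3L)` and `8L` from the squared distances, `8` from the motion of `D`,
  -- and twice `L(6, 1, 1)` from the kernels, on `Γ i ^ 2` and the `a`- and `b`-sums.
  set e := (16 * lam - 12 * L + 8) * Γ i ^ 2 + 10 * L * ∑ j, a j * Γ j ^ 2 +
    2 * L * ∑ j, b j * Γ j ^ 2 with he
  set y' : ℝ → E d := fun s => ι • (-∇ V (y i s)) + ∑ j, a j • K (y j s - y i s) with hy'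
  set w : ℝ → E d := fun s => -∇ V (z i s) + ∑ j, b j • K (z j s - z i s) with hw
  have hDdist : ∀ j, ∀ s ∈ Set.Icc t₀ (t₀ + κ),
      ‖(y j s - z j s) - (y j t₀ - z j t₀)‖ ≤ 2 * (κ * Γ j) := by
    intro j s hs
    have e1 : (y j s - z j s) - (y j t₀ - z j t₀) =
      (y j s - y j t₀) - (z j s - z j t₀) := by abel
    rw [e1]
    linarith [norm_sub_le (y j s - y j t₀) (z j s - z j t₀), hyΔ j s hs, hzΔ j s hs]
  have hDle : ∀ j, ∀ s ∈ Set.Icc t₀ (t₀ + κ), ‖y j s - z j s‖ ≤ 2 * Γ j := by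
    intro j s hs
    linarith [norm_sub_le (y j s) (z j s), hyΓ j s hs, hzΓ j s hs]
  have hDsq : ∀ j, ∀ s ∈ Set.Icc t₀ (t₀ + κ),
      |‖y j s - z j s‖ ^ 2 - ‖y j t₀ - z j t₀‖ ^ 2| ≤ 8 * κ * Γ j ^ 2 := fun j s hs =>
    sq_norm_le_of_norm_sub_le (hDle j s hs) (hDle j t₀ ht₀) (hDdist j s hs)
  have hder : ∀ s ∈ Set.Ico t₀ (t₀ + κ),
      2 * inner ℝ (y i s - z i s) (y' s - θ • w s) -
        2 * inner ℝ D₀ ((ι / θ - 1) • (θ • w s) + k₀) ≤ β + κ * e := by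
    intro s hs'
    have hs := Set.Ico_subset_Icc_self hs'
    set G : E d := ι • (-∇ V (z i s)) + ∑ j, a j • K (z j s - z i s) with hG
    set ks : E d := ∑ j, (a j - ι * b j) • K (z j s - z i s) with hks
    -- Both coefficients are centred once `a` is random: `ι` has mean `θ`, and `a j` has mean `θ * b
    -- j`.
    have hξ : G - θ • w s = (ι / θ - 1) • (θ • w s) + ks := by
      have e1 : (ι / θ - 1) • (θ • w s) = ι • w s - θ • w s := by
        rw [sub_smul, one_smul, smul_smul, div_mul_cancel₀ _ hθ.ne']
      have e2 : ks = ∑ j, a j • K (z j s - z i s) - ι • ∑ j, b j • K (z j s - z i s) := by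
        simp only [hks, sub_smul, Finset.sum_sub_distrib, Finset.smul_sum, mul_smul]
      rw [e1, e2, hG, hw]
      simp only [smul_add]
      abel
    have hw_le : ‖w s‖ ≤ Γ i := by
      have h1 := h.norm_sum_smul_le hb (fun j => z j s) i
      rw [hb1, one_mul] at h1
      have h2 := norm_add_le (-∇ V (z i s)) (∑ j, b j • K (z j s - z i s))
      rw [norm_neg] at h2
      linarith [hV s hs]
    have hG_le : ‖G‖ ≤ Γ i := by
      have h1 := h.norm_sum_smul_le ha (fun j => z j s) i
      have h2 := norm_add_le (ι • (-∇ V (z i s))) (∑ j, a j • K (z j s - z i s))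
      rw [norm_smul, norm_neg, Real.norm_of_nonneg hι0] at h2
      have h3 : ι * (‖∇ V (z i s)‖ + B) ≤ Γ i :=
        (mul_le_of_le_one_left (add_nonneg (norm_nonneg _) h.B_nonneg) ha1).trans (hV s hs)
      linarith
    have hξ_le : ‖G - θ • w s‖ ≤ 2 * Γ i := by
      have h1 := norm_sub_le G (θ • w s)
      rw [norm_smul, Real.norm_of_nonneg hθ.le] at h1
      have h2 := mul_le_of_le_one_left (norm_nonneg (w s)) hθ1
      linarith
    -- Dissipation, motion of `D` since the start of the step, and motion of the kernels; only the
    -- last two need the smallness of the step.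
    have hsplit : 2 * inner ℝ (y i s - z i s) (y' s - θ • w s) -
        2 * inner ℝ D₀ ((ι / θ - 1) • (θ • w s) + k₀) =
        2 * inner ℝ (y i s - z i s) (y' s - G) +
        2 * inner ℝ ((y i s - z i s) - D₀) (G - θ • w s) + 2 * inner ℝ D₀ (ks - k₀) := by
      have e1 : y' s - θ • w s = (y' s - G) + (G - θ • w s) := by abel
      have e2 : (ι / θ - 1) • (θ • w s) + k₀ = (G - θ • w s) - (ks - k₀) := by
        rw [hξ]; abel
      rw [e1, e2, inner_add_right, inner_sub_left (y i s - z i s) D₀ (G - θ • w s),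
        inner_sub_right D₀ (G - θ • w s) (ks - k₀)]
      ring
    have hmono := h.two_inner_drift_sub_le ha (fun j => y j s) (fun j => z j s) i
    have t1 : -(2 * lam - 3 * L) * ι * ‖y i s - z i s‖ ^ 2 ≤
        -(2 * lam - 3 * L) * ι * ‖D₀‖ ^ 2 + (2 * lam - 3 * L) * (8 * κ * Γ i ^ 2) := by
      have h1 := (abs_le.1 (hDsq i s hs)).1
      have h2 : (2 * lam - 3 * L) * (ι * (8 * κ * Γ i ^ 2)) ≤
          (2 * lam - 3 * L) * (8 * κ * Γ i ^ 2) :=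
        mul_le_mul_of_nonneg_left (mul_le_of_le_one_left (by positivity) ha1) (by linarith)
      have h3 : 0 ≤ (2 * lam - 3 * L) * ι := mul_nonneg (by linarith) hι0
      nlinarith [mul_le_mul_of_nonneg_left h1 h3]
    have t2 : L * ∑ j, a j * ‖y j s - z j s‖ ^ 2 ≤
        L * ∑ j, a j * ‖y j t₀ - z j t₀‖ ^ 2 + 8 * κ * L * ∑ j, a j * Γ j ^ 2 := by
      have : ∑ j, a j * ‖y j s - z j s‖ ^ 2 ≤
          ∑ j, (a j * ‖y j t₀ - z j t₀‖ ^ 2 + 8 * κ * (a j * Γ j ^ 2)) := by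
        refine Finset.sum_le_sum fun j _ => ?_
        have := mul_le_mul_of_nonneg_left (abs_le.1 (hDsq j s hs)).2 (ha j)
        linarith
      rw [Finset.sum_add_distrib, ← Finset.mul_sum] at this
      have := mul_le_mul_of_nonneg_left this hL
      linarith
    have t3 : inner ℝ ((y i s - z i s) - D₀) (G - θ • w s) ≤ 4 * κ * Γ i ^ 2 := by
      refine (real_inner_le_norm _ _).trans ?_
      refine (mul_le_mul (hDdist i s hs) hξ_le (norm_nonneg _) ?_).trans_eq (by ring)
      have := hΓ i
      positivity
    have t4 : inner ℝ D₀ (ks - k₀) ≤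
        L * κ * ∑ j, (a j + b j) * (3 * Γ i ^ 2 + Γ j ^ 2) := by
      have e1 : ks - k₀ =
          ∑ j, (a j - ι * b j) • (K (z j s - z i s) - K (z j t₀ - z i t₀)) := by
        simp only [hks, hk₀, smul_sub, Finset.sum_sub_distrib]
      rw [e1, inner_sum, Finset.mul_sum]
      refine Finset.sum_le_sum fun j _ => ?_
      rw [inner_smul_right]
      have h1 : ‖K (z j s - z i s) - K (z j t₀ - z i t₀)‖ ≤ L * (κ * Γ i + κ * Γ j) :=
        (h.norm_kernel_sub_le (fun j => z j s) (fun j => z j t₀) i j).trans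
          (mul_le_mul_of_nonneg_left (add_le_add (hzΔ i s hs) (hzΔ j s hs)) hL)
      have h2 : |inner ℝ D₀ (K (z j s - z i s) - K (z j t₀ - z i t₀))| ≤
          2 * Γ i * (L * (κ * Γ i + κ * Γ j)) :=
        (abs_real_inner_le_norm _ _).trans
          (mul_le_mul (hDle i t₀ ht₀) h1 (norm_nonneg _) (by linarith [hΓ i]))
      have h3 : |a j - ι * b j| ≤ a j + b j := by
        have := mul_le_of_le_one_left (hb j) ha1
        have := mul_nonneg hι0 (hb j)
        rw [abs_le]; constructor <;> linarith [ha j]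
      have h4 : 2 * Γ i * (L * (κ * Γ i + κ * Γ j)) ≤ L * κ * (3 * Γ i ^ 2 + Γ j ^ 2) := by
        have : 0 ≤ L * κ * (Γ i - Γ j) ^ 2 := by positivity
        nlinarith
      calc _ ≤ |(a j - ι * b j) * inner ℝ D₀ (K (z j s - z i s) - K (z j t₀ - z i t₀))| :=
            le_abs_self _
        _ ≤ (a j + b j) * (L * κ * (3 * Γ i ^ 2 + Γ j ^ 2)) := by
            rw [abs_mul]
            exact mul_le_mul h3 (h2.trans h4) (abs_nonneg _) (add_nonneg (ha j) (hb j))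
        _ = _ := by ring
    have t5 : ∑ j, (a j + b j) * (3 * Γ i ^ 2 + Γ j ^ 2) ≤
        6 * Γ i ^ 2 + ∑ j, a j * Γ j ^ 2 + ∑ j, b j * Γ j ^ 2 := by
      simp only [mul_add, add_mul, Finset.sum_add_distrib, ← Finset.sum_mul]
      rw [hb1]
      have := mul_le_of_le_one_left (by positivity : 0 ≤ 3 * Γ i ^ 2) ha1
      linarith
    have t6 := mul_le_mul_of_nonneg_left t5 (mul_nonneg hL hκ)
    rw [hsplit]
    calc _ ≤ (-(2 * lam - 3 * L) * ι * ‖D₀‖ ^ 2 + (2 * lam - 3 * L) * (8 * κ * Γ i ^ 2)) +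
          (L * ∑ j, a j * ‖y j t₀ - z j t₀‖ ^ 2 + 8 * κ * L * ∑ j, a j * Γ j ^ 2) +
          2 * (4 * κ * Γ i ^ 2) +
          2 * (L * κ * (6 * Γ i ^ 2 + ∑ j, a j * Γ j ^ 2 + ∑ j, b j * Γ j ^ 2)) := by
          linarith
      _ = _ := by rw [hβ, he]; ring
  have key := sq_norm_sub_le_of_deriv_le hκ hyc hzc hy hz hder
  rw [inner_smul_right] at key
  linarith

/-- Two solutions driven by the same weights diverge at most exponentially. -/
theorem Admissible.sum_sq_norm_sub_le (h : Admissible lam L B A q V K)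
    {a : ℝ → Fin N → Fin N → ℝ} (ha : ∀ t i j, 0 ≤ a t i j) (ha1 : ∀ t i, ∑ j, a t i j ≤ 1)
    {y z : Fin N → ℝ → E d} {τ : ℝ} (hτ : 0 ≤ τ)
    (hyc : ∀ i, ContinuousOn (y i) (Set.Icc 0 τ)) (hzc : ∀ i, ContinuousOn (z i) (Set.Icc 0 τ))
    (hy : ∀ i, ∀ s ∈ Set.Ico 0 τ, HasDerivWithinAt (y i)
      ((∑ j, a s i j) • (-∇ V (y i s)) + ∑ j, a s i j • K (y j s - y i s)) (Set.Ici s) s)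
    (hz : ∀ i, ∀ s ∈ Set.Ico 0 τ, HasDerivWithinAt (z i)
      ((∑ j, a s i j) • (-∇ V (z i s)) + ∑ j, a s i j • K (z j s - z i s)) (Set.Ici s) s) :
    ∑ i, ‖y i τ - z i τ‖ ^ 2 ≤ (∑ i, ‖y i 0 - z i 0‖ ^ 2) * Real.exp (L * N * τ) := by
  have hL := L.coe_nonneg
  have hgt := h.lam_gt
  have key := le_gronwallBound_of_liminf_deriv_right_le (f := fun s => ∑ i, ‖y i s - z i s‖ ^ 2)
    (f' := fun s => ∑ i, 2 * inner ℝ (y i s - z i s)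
      (((∑ j, a s i j) • (-∇ V (y i s)) + ∑ j, a s i j • K (y j s - y i s)) -
        ((∑ j, a s i j) • (-∇ V (z i s)) + ∑ j, a s i j • K (z j s - z i s))))
    (δ := ∑ i, ‖y i 0 - z i 0‖ ^ 2) (K := L * N) (ε := 0) (a := 0) (b := τ)
    (continuousOn_finsetSum _ fun i _ => by
      have := hyc i; have := hzc i; fun_prop)
    (fun s hs r hr => HasDerivWithinAt.liminf_right_slope_le
      (HasDerivWithinAt.fun_sum fun i _ => ((hy i s hs).sub (hz i s hs)).norm_sq) hr)
    le_rfl (fun s hs => ?_) τ (Set.right_mem_Icc.2 hτ)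
  · rwa [gronwallBound_ε0, sub_zero] at key
  · rw [add_zero]
    -- The dissipation is discarded and the weights are bounded by one: the crude rate `L * N` only
    -- serves to get Lipschitz dependence on the initial data.
    calc _ ≤ ∑ i : Fin N, (L : ℝ) * ∑ j, ‖y j s - z j s‖ ^ 2 := by
          refine Finset.sum_le_sum fun i _ => ?_
          refine (h.two_inner_drift_sub_le (ha s i) (fun j => y j s) (fun j => z j s) i).trans ?_
          have h1 : 0 ≤ (2 * lam - 3 * L) * (∑ j, a s i j) * ‖y i s - z i s‖ ^ 2 :=
            mul_nonneg (mul_nonneg (by linarith) (Finset.sum_nonneg fun j _ => ha s i j))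
              (by positivity)
          have h2 : ∑ j, a s i j * ‖y j s - z j s‖ ^ 2 ≤ ∑ j, ‖y j s - z j s‖ ^ 2 :=
            Finset.sum_le_sum fun j _ => mul_le_of_le_one_left (by positivity)
              ((Finset.single_le_sum (fun j _ => ha s i j) (Finset.mem_univ j)).trans (ha1 s i))
          have := mul_le_mul_of_nonneg_left h2 hL
          linarith
      _ = _ := by simp; ring

end Pathwise

end RBM

namespace RBM

/-! ### Paths of batch dynamics -/

/-- A bound for the position and the speed of a particle in terms of `r`, the norm of its initial
position. -/
noncomputable def pathBound (lam B A q r : ℝ) : ℝ :=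
  (A * (1 + 2 ^ q * ((A + B) / lam) ^ q) + B + (A + B) / lam + 2 * A / lam) +
    (A * 2 ^ q + A / lam) * r ^ q

theorem add_rpow_le_two_rpow_mul {a b q : ℝ} (ha : 0 ≤ a) (hb : 0 ≤ b) (hq : 0 < q) :
    (a + b) ^ q ≤ 2 ^ q * (a ^ q + b ^ q) := by
  have hm : 0 ≤ max a b := ha.trans (le_max_left _ _)
  calc (a + b) ^ q ≤ (2 * max a b) ^ q :=
        Real.rpow_le_rpow (add_nonneg ha hb)
          (by linarith [le_max_left a b, le_max_right a b]) hq.le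
    _ = 2 ^ q * (max a b) ^ q := Real.mul_rpow (by norm_num) hm
    _ ≤ 2 ^ q * (a ^ q + b ^ q) := by
        refine mul_le_mul_of_nonneg_left ?_ (by positivity)
        have h1 := Real.rpow_nonneg ha q
        have h2 := Real.rpow_nonneg hb q
        rcases max_cases a b with ⟨h, -⟩ | ⟨h, -⟩ <;> rw [h] <;> linarith

/-- `y` is a path of the batch dynamics with batches `S` of size `p` and time step `κ`. -/
structure IsBatchPath {d N : ℕ} (V : E d → ℝ) (K : E d → E d) (p : ℕ) (κ : ℝ)
    (S : ℕ → Finset (Fin N)) (y : Fin N → ℝ → E d) : Prop where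
  continuousOn : ∀ i, ContinuousOn (y i) (Set.Ici 0)
  ode : ∀ i, ∀ t ≥ 0, HasDerivWithinAt (y i)
    (batchDrift V K p (S ⌊t / κ⌋₊) (fun j => y j t) i) (Set.Ici t) t

section

variable {d N p : ℕ} {lam : ℝ} {L : ℝ≥0} {B A q : ℝ} {V : E d → ℝ} {K : E d → E d}
  {κ : ℝ} {S : ℕ → Finset (Fin N)} {y : Fin N → ℝ → E d}

theorem Admissible.norm_le_pathBound (h : Admissible lam L B A q V K) (hq : 0 < q)
    {x x₀ : E d} (hx : ‖x‖ ≤ ‖x₀‖ + (A + B) / lam) : ‖x‖ ≤ pathBound lam B A q ‖x₀‖ := by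
  have hlam := h.lam_pos
  have hA := h.A_nonneg hq
  have hB := h.B_nonneg
  have h1 : ‖x₀‖ ≤ 2 * A / lam + A / lam * ‖x₀‖ ^ q := by
    rw [div_mul_eq_mul_div, ← add_div, le_div_iff₀ hlam]
    linarith [h.lam_mul_norm_le hq x₀]
  have h2 : 0 ≤ A * (1 + 2 ^ q * ((A + B) / lam) ^ q) := by positivity
  have h3 : 0 ≤ A * 2 ^ q * ‖x₀‖ ^ q := by positivity
  unfold pathBound
  linarith

theorem Admissible.norm_gradient_le_pathBound (h : Admissible lam L B A q V K) (hq : 0 < q)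
    {x x₀ : E d} (hx : ‖x‖ ≤ ‖x₀‖ + (A + B) / lam) :
    ‖∇ V x‖ + B ≤ pathBound lam B A q ‖x₀‖ := by
  have hlam := h.lam_pos
  have hA := h.A_nonneg hq
  have hB := h.B_nonneg
  have hρ : 0 ≤ (A + B) / lam := by positivity
  have h1 : ‖x‖ ^ q ≤ 2 ^ q * (‖x₀‖ ^ q + ((A + B) / lam) ^ q) :=
    (Real.rpow_le_rpow (norm_nonneg _) hx hq.le).trans
      (add_rpow_le_two_rpow_mul (norm_nonneg _) hρ hq)
  have h2 := (h.growth x).trans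
    (mul_le_mul_of_nonneg_left (add_le_add_right h1 1) hA)
  have h3 : 0 ≤ 2 * A / lam := by positivity
  have h4 : 0 ≤ A / lam * ‖x₀‖ ^ q := by positivity
  unfold pathBound
  linarith

theorem IsBatchPath.norm_le (hy : IsBatchPath V K p κ S y) (h : Admissible lam L B A q V K)
    (hq : 0 < q) (hp : 2 ≤ p) (hS : ∀ k, (S k).card = p) (i : Fin N) {t : ℝ} (ht : 0 ≤ t) :
    ‖y i t‖ ≤ ‖y i 0‖ + (A + B) / lam := by
  refine h.norm_le_of_hasDerivWithinAt hq (ι := fun t => activity (S ⌊t / κ⌋₊) i)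
    (k := fun t => ∑ j, batchWeight p (S ⌊t / κ⌋₊) i j • K (y j t - y i t))
    (fun _ => activity_nonneg _ _) (fun t => ?_) (hy.continuousOn i) (fun t ht => ?_) ht
  · have := h.norm_sum_smul_le (batchWeight_nonneg hp (S ⌊t / κ⌋₊) i) (fun j => y j t) i
    rwa [sum_batchWeight hp (hS _)] at this
  · have := hy.ode i t ht
    rwa [batchDrift_eq] at this

theorem Admissible.norm_batchDrift_le (h : Admissible lam L B A q V K) (hp : 2 ≤ p)
    {S : Finset (Fin N)} (hS : S.card = p) (x : Fin N → E d) (i : Fin N) :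
    ‖batchDrift V K p S x i‖ ≤ ‖∇ V (x i)‖ + B := by
  rw [batchDrift_eq]
  have h1 := h.norm_sum_smul_le (batchWeight_nonneg hp S i) x i
  rw [sum_batchWeight hp hS] at h1
  refine (norm_add_le _ _).trans (add_le_add ?_ (h1.trans ?_))
  · rw [norm_smul, norm_neg, Real.norm_of_nonneg (activity_nonneg _ _)]
    exact mul_le_of_le_one_left (norm_nonneg _) (activity_le_one _ _)
  · exact mul_le_of_le_one_left h.B_nonneg (activity_le_one _ _)

theorem IsBatchPath.norm_sub_le (hy : IsBatchPath V K p κ S y)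
    (h : Admissible lam L B A q V K) (hq : 0 < q) (hp : 2 ≤ p) (hS : ∀ k, (S k).card = p)
    (i : Fin N) {s t : ℝ} (hs : 0 ≤ s) (hst : s ≤ t) :
    ‖y i t - y i s‖ ≤ (t - s) * pathBound lam B A q ‖y i 0‖ := by
  rw [mul_comm]
  refine norm_image_sub_le_of_norm_deriv_right_le_segment
    ((hy.continuousOn i).mono fun r hr => hs.trans hr.1)
    (fun r hr => hy.ode i r (hs.trans hr.1)) (fun r hr => ?_) t (Set.right_mem_Icc.2 hst)
  exact (h.norm_batchDrift_le hp (hS _) _ i).trans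
    (h.norm_gradient_le_pathBound hq (hy.norm_le h hq hp hS i (hs.trans hr.1)))

/-- Only the batches used before `τ` matter. This yields measurable dependence of the state on the
initial data and the past batches; its constant never enters the final estimate. -/
theorem IsBatchPath.dist_le (hy : IsBatchPath V K p κ S y) {S' : ℕ → Finset (Fin N)}
    {z : Fin N → ℝ → E d} (hz : IsBatchPath V K p κ S' z) (h : Admissible lam L B A q V K)
    (hp : 2 ≤ p) (hS : ∀ k, (S k).card = p) {τ : ℝ} (hτ : 0 ≤ τ)
    (hSS' : ∀ t ∈ Set.Ico 0 τ, S ⌊t / κ⌋₊ = S' ⌊t / κ⌋₊) :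
    dist (fun i => y i τ) (fun i => z i τ) ≤
      √(N * Real.exp (L * N * τ)) * dist (fun i => y i 0) (fun i => z i 0) := by
  set δ := dist (fun i => y i 0) (fun i => z i 0) with hδ
  have hsum : ∀ t i, ∑ j, batchWeight p (S ⌊t / κ⌋₊) i j = activity (S ⌊t / κ⌋₊) i :=
    fun t i => sum_batchWeight hp (hS _) i
  have key := h.sum_sq_norm_sub_le (a := fun t i j => batchWeight p (S ⌊t / κ⌋₊) i j)
    (y := y) (z := z) (fun t i j => batchWeight_nonneg hp _ _ _)
    (fun t i => (hsum t i).trans_le (activity_le_one _ _)) hτ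
    (fun i => (hy.continuousOn i).mono Set.Icc_subset_Ici_self)
    (fun i => (hz.continuousOn i).mono Set.Icc_subset_Ici_self)
    (fun i s hs => by
      have := hy.ode i s hs.1
      rw [batchDrift_eq] at this
      rwa [hsum])
    (fun i s hs => by
      have := hz.ode i s hs.1
      rw [← hSS' s hs, batchDrift_eq] at this
      rwa [hsum])
  rw [dist_pi_le_iff (by positivity)]
  intro i
  rw [dist_eq_norm]
  refine abs_le_of_sq_le_sq' ?_ (by positivity) |>.2
  have h0 : ∑ i, ‖y i 0 - z i 0‖ ^ 2 ≤ N * δ ^ 2 := by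
    calc ∑ i, ‖y i 0 - z i 0‖ ^ 2 ≤ ∑ _i : Fin N, δ ^ 2 := by
          refine Finset.sum_le_sum fun i _ => pow_le_pow_left₀ (norm_nonneg _) ?_ 2
          rw [← dist_eq_norm]
          exact dist_le_pi_dist (fun i => y i 0) (fun i => z i 0) i
      _ = N * δ ^ 2 := by simp
  rw [mul_pow, Real.sq_sqrt (by positivity)]
  calc ‖y i τ - z i τ‖ ^ 2 ≤ ∑ i, ‖y i τ - z i τ‖ ^ 2 :=
        Finset.single_le_sum (f := fun i => ‖y i τ - z i τ‖ ^ 2) (fun _ _ => by positivity)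
          (Finset.mem_univ i)
    _ ≤ _ := key
    _ ≤ N * δ ^ 2 * Real.exp (L * N * τ) := by gcongr
    _ = _ := by ring

/-- One step of the coupling between the random batch dynamics and the full system run with
speed `p / N`, for a fixed realization of the batches. -/
theorem IsBatchPath.sq_norm_sub_step_le (hy : IsBatchPath V K p κ S y) {x : Fin N → ℝ → E d}
    (hx : IsBatchPath V K N κ (fun _ => Finset.univ) x) (h : Admissible lam L B A q V K)
    (hq : 0 < q) (hp : 2 ≤ p) (hpN : p ≤ N) (hκ : 0 < κ) (hS : ∀ k, (S k).card = p)
    (hxy : ∀ j, y j 0 = x j 0) (k : ℕ) (i : Fin N) {θ : ℝ} (hθ : θ = p / N) {Γ : Fin N → ℝ}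
    (hΓ : ∀ j, Γ j = pathBound lam B A q ‖x j 0‖) {z : Fin N → ℝ → E d}
    (hz : ∀ j s, z j s = x j (θ * s)) :
    ‖y i ((k + 1) * κ) - z i ((k + 1) * κ)‖ ^ 2 ≤ ‖y i (k * κ) - z i (k * κ)‖ ^ 2 +
      2 * ((activity (S k) i / θ - 1) *
        inner ℝ (y i (k * κ) - z i (k * κ)) (z i ((k + 1) * κ) - z i (k * κ))) +
      2 * κ * ∑ j, (batchWeight p (S k) i j - activity (S k) i *
          batchWeight N Finset.univ i j) *
        inner ℝ (y i (k * κ) - z i (k * κ)) (K (z j (k * κ) - z i (k * κ))) +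
      κ * (-(2 * lam - 3 * L) * activity (S k) i * ‖y i (k * κ) - z i (k * κ)‖ ^ 2 +
        L * ∑ j, batchWeight p (S k) i j * ‖y j (k * κ) - z j (k * κ)‖ ^ 2) +
      κ ^ 2 * ((16 * lam - 12 * L + 8) * Γ i ^ 2 +
        10 * L * ∑ j, batchWeight p (S k) i j * Γ j ^ 2 +
        2 * L * ∑ j, batchWeight N Finset.univ i j * Γ j ^ 2) := by
  have hN : 2 ≤ N := hp.trans hpN
  have hN0 : (0 : ℝ) < N := by exact_mod_cast (by lia : 0 < N)
  have hp0 : (0 : ℝ) < p := by exact_mod_cast (by lia : 0 < p)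
  have hθ0 : 0 < θ := hθ ▸ div_pos hp0 hN0
  have hθ1 : θ ≤ 1 := hθ ▸ (div_le_one hN0).2 (by exact_mod_cast hpN)
  have hU : ∀ _ : ℕ, (Finset.univ : Finset (Fin N)).card = N := fun _ => by simp
  have hk0 : 0 ≤ k * κ := by positivity
  have hzero : ∀ {s : ℝ}, k * κ ≤ s → 0 ≤ s := fun hs => hk0.trans hs
  have hzero' : ∀ {s : ℝ}, k * κ ≤ s → 0 ≤ θ * s := fun hs => mul_nonneg hθ0.le (hzero hs)
  have hsum := sum_batchWeight hp (hS k) i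
  have hsumN : ∑ j, batchWeight N Finset.univ i j = 1 := by
    rw [sum_batchWeight hN (hU 0)]; simp [activity]
  have hΓ0 : ∀ j, 0 ≤ Γ j := fun j =>
    (norm_nonneg (x j 0)).trans (hΓ j ▸ h.norm_le_pathBound hq (by
      have := div_nonneg (add_nonneg (h.A_nonneg hq) h.B_nonneg) h.lam_pos.le
      linarith))
  have e : ((k : ℝ) + 1) * κ = k * κ + κ := by ring
  rw [e, ← hsum]
  refine h.sq_norm_sub_step_le (batchWeight_nonneg hp (S k) i)
    (batchWeight_nonneg hN Finset.univ i) (hsum.trans_le (activity_le_one _ _)) hsumN hθ0 hθ1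
    hκ.le ((hy.continuousOn i).mono fun s hs => hzero hs.1) ?_ ?_ ?_ ?_ ?_ ?_ ?_ ?_
  · have e1 : z i = (x i) ∘ (fun s => θ * s) := funext fun s => hz i s
    rw [e1]
    exact (hx.continuousOn i).comp (by fun_prop) fun s hs => hzero' hs.1
  · intro s hs
    have hfloor : ⌊s / κ⌋₊ = k := by
      rw [Nat.floor_eq_iff (div_nonneg (hzero hs.1) hκ.le), le_div_iff₀ hκ, div_lt_iff₀ hκ, e]
      exact hs
    have := hy.ode i s (hzero hs.1)
    rwa [hfloor, batchDrift_eq, ← hsum] at this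
  · intro s hs
    have h1 := hx.ode i (θ * s) (hzero' hs.1)
    have h2 : HasDerivWithinAt (fun s => θ * s) θ (Set.Ici s) s := by
      simpa using ((hasDerivAt_id s).const_mul θ).hasDerivWithinAt
    -- The time change `s ↦ θ * s` produces the factor `θ` in the velocity of `z`.
    have h3 := h1.scomp s h2 (fun r hr => mul_le_mul_of_nonneg_left hr hθ0.le)
    have e1 : z i = (x i) ∘ (fun s => θ * s) := funext fun s => hz i s
    rw [e1]
    refine h3.congr_deriv ?_
    rw [batchDrift_eq]
    simp [activity, hz]
  · intro j s hs
    rw [hΓ, ← hxy j]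
    exact h.norm_le_pathBound hq (hy.norm_le h hq hp hS j (hzero hs.1))
  · intro j s hs
    rw [hΓ, hz]
    exact h.norm_le_pathBound hq (hx.norm_le h hq hN hU j (hzero' hs.1))
  · intro j s hs
    refine (hy.norm_sub_le h hq hp hS j hk0 hs.1).trans ?_
    rw [hxy j, ← hΓ j]
    exact mul_le_mul_of_nonneg_right (by linarith [hs.2]) (hΓ0 j)
  · intro j s hs
    rw [hz, hz]
    refine (hx.norm_sub_le h hq hN hU j (hzero' le_rfl)
      (mul_le_mul_of_nonneg_left hs.1 hθ0.le)).trans ?_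
    rw [← hΓ j]
    refine mul_le_mul_of_nonneg_right ?_ (hΓ0 j)
    rw [← mul_sub]
    exact (mul_le_of_le_one_left (by linarith [hs.1]) hθ1).trans (by linarith [hs.2])
  · intro s hs
    rw [hΓ, hz]
    exact h.norm_gradient_le_pathBound hq (hx.norm_le h hq hN hU i (hzero' hs.1))

end

end RBM

namespace RBM

/-! ### Measurable factorization and independence -/

section Factor

variable {Ω J F G : Type*} [Countable J] [MeasurableSpace J] [MeasurableSingletonClass J]
  [PseudoMetricSpace F] [MeasurableSpace F] [BorelSpace F]
  [NormedAddCommGroup G] [NormedSpace ℝ G] [FiniteDimensional ℝ G] [MeasurableSpace G]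
  [BorelSpace G]

/-- A map that is Lipschitz in `x` for each fixed value of `j` is a measurable function of
`(j, x)`. -/
theorem exists_measurable_factor {good : Set Ω} {f : Ω → G} {j : Ω → J} {x : Ω → F} {c : ℝ}
    (hf : ∀ ω ∈ good, ∀ ω' ∈ good, j ω = j ω' → dist (f ω) (f ω') ≤ c * dist (x ω) (x ω')) :
    ∃ Φ : J × F → G, Measurable Φ ∧ ∀ ω ∈ good, f ω = Φ (j ω, x ω) := by
  classical
  have hex : ∀ a : J, ∃ g : F → G, Continuous g ∧ ∀ ω ∈ good, j ω = a → f ω = g (x ω) := by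
    intro a
    set s : Set F := {u | ∃ ω ∈ good, j ω = a ∧ x ω = u} with hs
    set g₀ : F → G := fun u => if hu : u ∈ s then f hu.choose else 0 with hg₀
    have hg₀_eq : ∀ u (hu : u ∈ s), g₀ u = f hu.choose := fun u hu => dif_pos hu
    have hlip : LipschitzOnWith c.toNNReal g₀ s := by
      refine LipschitzOnWith.of_dist_le_mul fun u hu v hv => ?_
      rw [hg₀_eq u hu, hg₀_eq v hv]
      obtain ⟨h1, h2, h3⟩ := hu.choose_spec
      obtain ⟨h1', h2', h3'⟩ := hv.choose_spec
      have := hf _ h1 _ h1' (h2.trans h2'.symm)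
      rw [h3, h3'] at this
      exact this.trans (mul_le_mul_of_nonneg_right (Real.le_coe_toNNReal c) dist_nonneg)
    -- The set `s` of attained values need not be measurable; extending to the whole space gives a
    -- continuous, hence measurable, function.
    obtain ⟨g, hg, hgs⟩ := hlip.extend_finite_dimension
    refine ⟨g, hg.continuous, fun ω hω hj => ?_⟩
    have hu : x ω ∈ s := ⟨ω, hω, hj, rfl⟩
    rw [← hgs hu, hg₀_eq _ hu]
    obtain ⟨h1, h2, h3⟩ := hu.choose_spec
    have := hf _ hω _ h1 (hj.trans h2.symm)
    rw [h3, dist_self, mul_zero] at this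
    exact dist_le_zero.1 this
  choose g hg hgf using hex
  exact ⟨fun u => g u.1 u.2, measurable_from_prod_countable_right fun a => (hg a).measurable,
    fun ω hω => hgf (j ω) ω hω rfl⟩

end Factor

/-- The three variables are mutually independent, and the product of their laws can be reassociated.
-/
theorem indepFun_prodMk_of_indepFun {Ω α β γ : Type*} [MeasurableSpace Ω] [MeasurableSpace α]
    [MeasurableSpace β] [MeasurableSpace γ] {P : Measure Ω} [IsProbabilityMeasure P]
    {f : Ω → α} {g : Ω → β} {h : Ω → γ} (hf : Measurable f) (hg : Measurable g)
    (hh : Measurable h) (hfg : IndepFun f g P) (hfgh : IndepFun (fun ω => (f ω, g ω)) h P) :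
    IndepFun f (fun ω => (g ω, h ω)) P := by
  have hgh : IndepFun g h P := hfgh.comp measurable_snd measurable_id
  rw [indepFun_iff_map_prod_eq_prod_map_map (by fun_prop) (by fun_prop)] at hfg hfgh hgh ⊢
  have := Measure.isProbabilityMeasure_map (μ := P) hf.aemeasurable
  have := Measure.isProbabilityMeasure_map (μ := P) hg.aemeasurable
  have := Measure.isProbabilityMeasure_map (μ := P) hh.aemeasurable
  rw [hgh, ← Measure.prodAssoc_prod, ← hfg, ← hfgh,
    Measure.map_map (MeasurableEquiv.measurable _) (by fun_prop)]
  rfl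

/-! ### Batches -/

section Batches

variable {d N p : ℕ} {Ω : Type*} [MeasurableSpace Ω] {P : Measure Ω} [IsProbabilityMeasure P]
  {X₀ : Fin N → Ω → E d} {𝒞 : ℕ → Ω → Finset (Fin N)}

theorem IsBatchSequence.ae_card (hC : IsBatchSequence P p X₀ 𝒞) (hpN : p ≤ N) :
    ∀ᵐ ω ∂P, ∀ k, (𝒞 k ω).card = p := by
  rw [ae_all_iff]
  intro k
  have hm : MeasurableSet {ω | (𝒞 k ω).card = p} :=
    hC.measurable k (Set.toFinite {S : Finset (Fin N) | S.card = p}).measurableSet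
  change {ω | (𝒞 k ω).card = p} ∈ ae P
  rw [mem_ae_iff_prob_eq_one hm]
  have e : {ω | (𝒞 k ω).card = p} =
      ⋃ S ∈ Finset.powersetCard p (Finset.univ : Finset (Fin N)), {ω | 𝒞 k ω = S} := by
    ext ω; simp
  rw [e, measure_biUnion_finset]
  · rw [Finset.sum_congr rfl fun S hS => hC.uniform k S (Finset.mem_powersetCard.1 hS).2]
    simp only [Finset.sum_const, Finset.card_powersetCard, Finset.card_univ, Fintype.card_fin,
      nsmul_eq_mul]
    exact ENNReal.mul_inv_cancel (by exact_mod_cast (Nat.choose_pos hpN).ne') (by simp)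
  · intro S _ S' _ hSS'
    exact Set.disjoint_left.2 fun ω h1 h2 => hSS' (h1.symm.trans h2)
  · exact fun S _ => hC.measurable k (measurableSet_singleton S)

/-- The law of a batch is invariant under relabelling the particles. -/
theorem IsBatchSequence.integral_map_equiv (hC : IsBatchSequence P p X₀ 𝒞) (hpN : p ≤ N)
    (k : ℕ) (σ : Equiv.Perm (Fin N)) (φ : Finset (Fin N) → ℝ) :
    ∫ ω, φ ((𝒞 k ω).map σ.toEmbedding) ∂P = ∫ ω, φ (𝒞 k ω) ∂P := by
  have hlaw : ∀ S, (P.map (𝒞 k)).real {S} =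
      if S.card = p then ((N.choose p : ℕ) : ℝ)⁻¹ else 0 := by
    intro S
    rw [map_measureReal_apply (hC.measurable k) (measurableSet_singleton S)]
    split_ifs with hS
    · have := hC.uniform k S hS
      rw [measureReal_def]
      change (P {ω | 𝒞 k ω = S}).toReal = _
      rw [this, ENNReal.toReal_inv, ENNReal.toReal_natCast]
    · rw [measureReal_def, ENNReal.toReal_eq_zero_iff]
      left
      refine measure_mono_null (t := {ω | ¬ ∀ k, (𝒞 k ω).card = p}) ?_ (hC.ae_card hpN)
      intro ω hω hω'
      have h1 : 𝒞 k ω = S := hω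
      exact hS (h1 ▸ hω' k)
  have hint : ∀ ψ : Finset (Fin N) → ℝ, ∫ ω, ψ (𝒞 k ω) ∂P =
      ∑ S, (if S.card = p then ((N.choose p : ℕ) : ℝ)⁻¹ else 0) * ψ S := by
    intro ψ
    have := Measure.isProbabilityMeasure_map (μ := P) (hC.measurable k).aemeasurable
    rw [← integral_map (hC.measurable k).aemeasurable
      (measurable_of_finite ψ).aestronglyMeasurable, integral_fintype (by simp)]
    simp only [hlaw, smul_eq_mul]
  rw [hint φ, hint fun S => φ (S.map σ.toEmbedding)]
  exact Fintype.sum_equiv σ.finsetCongr _ _ fun S => by simp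

theorem activity_map (σ : Equiv.Perm (Fin N)) (S : Finset (Fin N)) (i : Fin N) :
    activity (S.map σ.toEmbedding) (σ i) = activity S i := by
  simp [activity]

theorem batchWeight_map (p : ℕ) (σ : Equiv.Perm (Fin N)) (S : Finset (Fin N)) (i j : Fin N) :
    batchWeight p (S.map σ.toEmbedding) (σ i) (σ j) = batchWeight p S i j := by
  simp [batchWeight]

theorem IsBatchSequence.integrable_comp (hC : IsBatchSequence P p X₀ 𝒞) (k : ℕ)
    (φ : Finset (Fin N) → ℝ) : Integrable (fun ω => φ (𝒞 k ω)) P := by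
  refine Integrable.of_bound ((measurable_of_finite φ).comp (hC.measurable k)).aestronglyMeasurable
    (∑ S, ‖φ S‖) (Filter.Eventually.of_forall fun ω => ?_)
  exact Finset.single_le_sum (f := fun S => ‖φ S‖) (fun _ _ => norm_nonneg _)
    (Finset.mem_univ (𝒞 k ω))

theorem IsBatchSequence.integral_activity (hC : IsBatchSequence P p X₀ 𝒞) (hpN : p ≤ N)
    (k : ℕ) (i : Fin N) : ∫ ω, activity (𝒞 k ω) i ∂P = p / N := by
  have hN : (N : ℝ) ≠ 0 := by
    have := i.pos
    positivity
  have hsym : ∀ j, ∫ ω, activity (𝒞 k ω) j ∂P = ∫ ω, activity (𝒞 k ω) i ∂P := by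
    intro j
    -- By symmetry all labels have the same activity probability, and the activities add up to `p`.
    have := hC.integral_map_equiv hpN k (Equiv.swap i j) (fun S => activity S j)
    rw [← this]
    refine integral_congr_ae (Filter.Eventually.of_forall fun ω => ?_)
    have := activity_map (Equiv.swap i j) (𝒞 k ω) i
    rwa [Equiv.swap_apply_left] at this
  have hsum : ∑ j, ∫ ω, activity (𝒞 k ω) j ∂P = p := by
    rw [← integral_finsetSum _ fun j _ => hC.integrable_comp k (fun S => activity S j)]
    have : (fun ω => ∑ j, activity (𝒞 k ω) j) =ᵐ[P] fun _ => (p : ℝ) := by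
      filter_upwards [hC.ae_card hpN] with ω hω
      simp [activity, hω k]
    rw [integral_congr_ae this]
    simp
  simp only [hsym, Finset.sum_const, Finset.card_univ, Fintype.card_fin, nsmul_eq_mul] at hsum
  rw [eq_div_iff hN]
  linarith

theorem IsBatchSequence.integral_batchWeight (hC : IsBatchSequence P p X₀ 𝒞) (hp : 2 ≤ p)
    (hpN : p ≤ N) (k : ℕ) (i j : Fin N) :
    ∫ ω, batchWeight p (𝒞 k ω) i j ∂P = p / N * batchWeight N Finset.univ i j := by
  by_cases hij : j = i
  · simp [batchWeight, hij]
  have hN : (2 : ℝ) ≤ N := by exact_mod_cast hp.trans hpN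
  have hsym : ∀ l, l ≠ i →
      ∫ ω, batchWeight p (𝒞 k ω) i l ∂P = ∫ ω, batchWeight p (𝒞 k ω) i j ∂P := by
    intro l hl
    -- This transposition fixes `i`, so the mean weight is the same for all `l ≠ i`; the total is
    -- the mean activity of `i`.
    have := hC.integral_map_equiv hpN k (Equiv.swap j l) (fun S => batchWeight p S i l)
    rw [← this]
    refine integral_congr_ae (Filter.Eventually.of_forall fun ω => ?_)
    have := batchWeight_map p (Equiv.swap j l) (𝒞 k ω) i j
    rwa [Equiv.swap_apply_left, Equiv.swap_apply_of_ne_of_ne (Ne.symm hij) (Ne.symm hl)] at this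
  have hsum : ∑ l, ∫ ω, batchWeight p (𝒞 k ω) i l ∂P = p / N := by
    rw [← integral_finsetSum _ fun j _ => hC.integrable_comp k (fun S => batchWeight p S i j),
      ← hC.integral_activity hpN k i]
    refine integral_congr_ae ?_
    filter_upwards [hC.ae_card hpN] with ω hω
    exact sum_batchWeight hp (hω k) i
  have hself : ∫ ω, batchWeight p (𝒞 k ω) i i ∂P = 0 := by simp [batchWeight]
  rw [← Finset.add_sum_erase _ _ (Finset.mem_univ i), hself, zero_add,
    Finset.sum_congr rfl fun l hl => hsym l (Finset.ne_of_mem_erase hl), Finset.sum_const,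
    Finset.card_erase_of_mem (Finset.mem_univ i), Finset.card_univ, Fintype.card_fin,
    nsmul_eq_mul, Nat.cast_sub (by lia), Nat.cast_one] at hsum
  have hb : batchWeight N Finset.univ i j = 1 / ((N : ℝ) - 1) := by simp [batchWeight, hij]
  rw [hb, ← hsum]
  have : (N : ℝ) - 1 ≠ 0 := by linarith
  field_simp

theorem IsBatchSequence.indepFun_past (hC : IsBatchSequence P p X₀ 𝒞)
    (hX₀ : ∀ i, Measurable (X₀ i)) (k : ℕ) :
    IndepFun (𝒞 k) (fun ω => ((fun l : Finset.range k => 𝒞 l ω), fun i => X₀ i ω)) P := by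
  have h1 : IndepFun (𝒞 k) (fun ω (l : Finset.range k) => 𝒞 l ω) P :=
    (hC.indep.indepFun_finset {k} (Finset.range k) (by simp) hC.measurable).comp
      (φ := fun u : ({k} : Finset ℕ) → Finset (Fin N) => u ⟨k, Finset.mem_singleton_self k⟩)
      (measurable_pi_apply _) measurable_id
  have h2 : IndepFun (fun ω => (𝒞 k ω, fun l : Finset.range k => 𝒞 l ω))
      (fun ω i => X₀ i ω) P :=
    hC.indep_init.comp (φ := fun u : ℕ → Finset (Fin N) =>
      (u k, fun l : Finset.range k => u l)) (by fun_prop) measurable_id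
  exact indepFun_prodMk_of_indepFun (hC.measurable k)
    (measurable_pi_lambda _ fun l => hC.measurable l) (measurable_pi_lambda _ hX₀) h1 h2

end Batches

end RBM

namespace RBM

/-! ### Means of integrable random variables -/

section HasMean

variable {Ω : Type*} [MeasurableSpace Ω] {P : Measure Ω} {f g : Ω → ℝ} {u v : ℝ}

/-- `f` is integrable with integral `v`. -/
def HasMean (P : Measure Ω) (f : Ω → ℝ) (v : ℝ) : Prop := Integrable f P ∧ ∫ ω, f ω ∂P = v

theorem _root_.MeasureTheory.Integrable.hasMean (hf : Integrable f P) :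
    HasMean P f (∫ ω, f ω ∂P) := ⟨hf, rfl⟩

theorem HasMean.add (hf : HasMean P f u) (hg : HasMean P g v) :
    HasMean P (fun ω => f ω + g ω) (u + v) :=
  ⟨hf.1.add hg.1, by rw [integral_add hf.1 hg.1, hf.2, hg.2]⟩

theorem HasMean.const_mul (c : ℝ) (hf : HasMean P f u) : HasMean P (fun ω => c * f ω) (c * u) :=
  ⟨hf.1.const_mul c, by rw [integral_const_mul, hf.2]⟩

theorem HasMean.sum {ι : Type*} {s : Finset ι} {F : ι → Ω → ℝ} {w : ι → ℝ}
    (hF : ∀ i ∈ s, HasMean P (F i) (w i)) : HasMean P (fun ω => ∑ i ∈ s, F i ω) (∑ i ∈ s, w i) :=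
  ⟨integrable_finsetSum _ fun i hi => (hF i hi).1, by
    rw [integral_finsetSum _ fun i hi => (hF i hi).1]
    exact Finset.sum_congr rfl fun i hi => (hF i hi).2⟩

theorem HasMean.le (hf : HasMean P f u) (hg : HasMean P g v) (hfg : f ≤ᵐ[P] g) : u ≤ v := by
  rw [← hf.2, ← hg.2]
  exact integral_mono_ae hf.1 hg.1 hfg

theorem HasMean.mul_of_indepFun {α β : Type*} [MeasurableSpace α] [MeasurableSpace β]
    {X : Ω → α} {U : Ω → β} (hXU : IndepFun X U P) {φ : α → ℝ} {ψ : β → ℝ} (hφ : Measurable φ)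
    (hψ : Measurable ψ) (hf : HasMean P (fun ω => φ (X ω)) u)
    (hg : HasMean P (fun ω => ψ (U ω)) v) :
    HasMean P (fun ω => φ (X ω) * ψ (U ω)) (u * v) := by
  have hind : IndepFun (fun ω => φ (X ω)) (fun ω => ψ (U ω)) P := hXU.comp hφ hψ
  refine ⟨hind.integrable_mul hf.1 hg.1, ?_⟩
  rw [← hf.2, ← hg.2]
  exact hind.integral_mul_eq_mul_integral hf.1.aestronglyMeasurable hg.1.aestronglyMeasurable

end HasMean

/-! ### Moments of the path bound -/

section Moments

variable {d : ℕ} {Ω : Type*} [MeasurableSpace Ω] {P : Measure Ω}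

/-- A bound for the second moment of `pathBound` in terms of `M`, a bound for the moment of order
`2 q` of the initial position. -/
noncomputable def pathMoment (lam B A q M : ℝ) : ℝ :=
  2 * (A * (1 + 2 ^ q * ((A + B) / lam) ^ q) + B + (A + B) / lam + 2 * A / lam) ^ 2 +
    2 * (A * 2 ^ q + A / lam) ^ 2 * max M 0

theorem pathMoment_nonneg (lam B A q M : ℝ) : 0 ≤ pathMoment lam B A q M := by
  unfold pathMoment
  have := le_max_right M 0
  positivity

theorem integrable_norm_rpow_and_integral_le {q M : ℝ} (hq : 0 < q) {X : Ω → E d}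
    (hX : Measurable X) (hM : ∫⁻ ω, ‖X ω‖ₑ ^ (2 * q) ∂P ≤ ENNReal.ofReal M) :
    Integrable (fun ω => ‖X ω‖ ^ (2 * q)) P ∧ ∫ ω, ‖X ω‖ ^ (2 * q) ∂P ≤ max M 0 := by
  have hmeas : AEStronglyMeasurable (fun ω => ‖X ω‖ ^ (2 * q)) P :=
    (hX.norm.pow_const (2 * q)).aestronglyMeasurable
  have hnn : ∀ ω, 0 ≤ ‖X ω‖ ^ (2 * q) := fun ω => Real.rpow_nonneg (norm_nonneg _) _
  have hle : ∫⁻ ω, ENNReal.ofReal (‖X ω‖ ^ (2 * q)) ∂P ≤ ENNReal.ofReal M := by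
    refine le_trans (le_of_eq (lintegral_congr fun ω => ?_)) hM
    rw [← ENNReal.ofReal_rpow_of_nonneg (norm_nonneg _) (by positivity), ofReal_norm]
  constructor
  · refine ⟨hmeas, ?_⟩
    rw [hasFiniteIntegral_iff_ofReal (Filter.Eventually.of_forall hnn)]
    exact hle.trans_lt ENNReal.ofReal_lt_top
  · rw [integral_eq_lintegral_of_nonneg_ae (Filter.Eventually.of_forall hnn) hmeas]
    refine (ENNReal.toReal_mono ENNReal.ofReal_ne_top hle).trans ?_
    rw [ENNReal.toReal_ofReal']

theorem integrable_pathBound_sq_and_integral_le [IsProbabilityMeasure P] {lam B A q M : ℝ} (hq : 0 < q) {X : Ω → E d}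
    (hX : Measurable X) (hM : ∫⁻ ω, ‖X ω‖ₑ ^ (2 * q) ∂P ≤ ENNReal.ofReal M) :
    Integrable (fun ω => pathBound lam B A q ‖X ω‖ ^ 2) P ∧
      ∫ ω, pathBound lam B A q ‖X ω‖ ^ 2 ∂P ≤ pathMoment lam B A q M := by
  obtain ⟨hint, hle⟩ := integrable_norm_rpow_and_integral_le hq hX hM
  set c₀ := A * (1 + 2 ^ q * ((A + B) / lam) ^ q) + B + (A + B) / lam + 2 * A / lam with hc₀
  set c₁ := A * 2 ^ q + A / lam with hc₁
  have hpt : ∀ ω, pathBound lam B A q ‖X ω‖ ^ 2 ≤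
      2 * c₀ ^ 2 + 2 * c₁ ^ 2 * ‖X ω‖ ^ (2 * q) := by
    intro ω
    have e : ‖X ω‖ ^ (2 * q) = (‖X ω‖ ^ q) ^ 2 := by
      rw [mul_comm, Real.rpow_mul (norm_nonneg _)]
      norm_num
    rw [e, pathBound, ← hc₀, ← hc₁]
    nlinarith [sq_nonneg (c₀ - c₁ * ‖X ω‖ ^ q)]
  have hint' : Integrable (fun ω => 2 * c₀ ^ 2 + 2 * c₁ ^ 2 * ‖X ω‖ ^ (2 * q)) P :=
    (integrable_const _).add (hint.const_mul _)
  have hmeas : Measurable fun ω => pathBound lam B A q ‖X ω‖ ^ 2 := by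
    unfold pathBound
    exact ((((hX.norm.pow_const q).const_mul _).const_add _).pow_const 2)
  have hint₂ : Integrable (fun ω => pathBound lam B A q ‖X ω‖ ^ 2) P :=
    hint'.mono' hmeas.aestronglyMeasurable (Filter.Eventually.of_forall fun ω => by
      rw [Real.norm_of_nonneg (sq_nonneg _)]
      exact hpt ω)
  refine ⟨hint₂, (integral_mono hint₂ hint' hpt).trans ?_⟩
  rw [integral_add (integrable_const _) (hint.const_mul _), integral_const, probReal_univ,
    one_smul, integral_const_mul]
  unfold pathMoment
  rw [← hc₀, ← hc₁]
  have := mul_le_mul_of_nonneg_left hle (by positivity : 0 ≤ 2 * c₁ ^ 2)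
  linarith

end Moments

/-! ### The coupled processes -/

section Coupling

variable {d N p : ℕ} {lam : ℝ} {L : ℝ≥0} {B A q M κ : ℝ} {V : E d → ℝ} {K : E d → E d}
  {Ω : Type*} [MeasurableSpace Ω] {P : Measure Ω} [IsProbabilityMeasure P]
  {X₀ : Fin N → Ω → E d} {𝒞 : ℕ → Ω → Finset (Fin N)} {X Y : Fin N → ℝ → Ω → E d}

/-- A realization for which `x` solves the full system and `y` the random batch dynamics with
batches `S`, both started from `x₀`. -/
structure IsCoupledPath (V : E d → ℝ) (K : E d → E d) (p : ℕ) (κ : ℝ) (S : ℕ → Finset (Fin N))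
    (x₀ : Fin N → E d) (x y : Fin N → ℝ → E d) : Prop where
  card : ∀ k, (S k).card = p
  ips : IsBatchPath V K N κ (fun _ => Finset.univ) x
  rbm : IsBatchPath V K p κ S y
  ips_init : ∀ i, x i 0 = x₀ i
  rbm_init : ∀ i, y i 0 = x₀ i

theorem ae_isCoupledPath (hpN : p ≤ N) (hC : IsBatchSequence P p X₀ 𝒞)
    (hX : IsIPS P V K X₀ X) (hY : IsRBMr P V K p κ X₀ 𝒞 Y) :
    ∀ᵐ ω ∂P, IsCoupledPath V K p κ (fun k => 𝒞 k ω) (fun i => X₀ i ω)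
      (fun i t => X i t ω) (fun i t => Y i t ω) := by
  filter_upwards [hC.ae_card hpN, hX.init, hX.continuous, hX.ode, hY.init, hY.continuous,
    hY.ode] with ω h1 h2 h3 h4 h5 h6 h7
  refine ⟨h1, ⟨h3, fun i t ht => ?_⟩, ⟨h6, h7⟩, h2, h5⟩
  rw [← ipsDrift_eq_batchDrift]
  exact h4 i t ht

/-- The batch `𝒞 k` is independent of the state of the coupled processes at time `k κ`. -/
theorem indepFun_state (h : Admissible lam L B A q V K) (hp : 2 ≤ p) (hpN : p ≤ N)
    (hκ : 0 < κ) (hX₀ : ∀ i, Measurable (X₀ i)) (hC : IsBatchSequence P p X₀ 𝒞)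
    (hX : IsIPS P V K X₀ X) (hY : IsRBMr P V K p κ X₀ 𝒞 Y) (k : ℕ) {s t : ℝ} (hs : 0 ≤ s)
    (ht : 0 ≤ t) :
    IndepFun (𝒞 k) (fun ω => ((fun i => X₀ i ω), (fun i => Y i (k * κ) ω),
      (fun i => X i s ω), (fun i => X i t ω))) P := by
  set good : Set Ω := {ω | IsCoupledPath V K p κ (fun k => 𝒞 k ω) (fun i => X₀ i ω)
      (fun i t => X i t ω) (fun i t => Y i t ω)} with hgood
  set J : Ω → (Finset.range k → Finset (Fin N)) := fun ω l => 𝒞 l ω with hJ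
  have hN : 2 ≤ N := hp.trans hpN
  have hXfac : ∀ r : ℝ, 0 ≤ r → ∃ Φ : (Finset.range k → Finset (Fin N)) × (Fin N → E d) →
      (Fin N → E d), Measurable Φ ∧ ∀ ω ∈ good, (fun i => X i r ω) = Φ (J ω, fun i => X₀ i ω) := by
    intro r hr
    refine exists_measurable_factor (c := √(N * Real.exp (L * N * r)))
      fun ω hω ω' hω' _ => ?_
    have := hω.ips.dist_le hω'.ips h hN (fun _ => by simp) hr (fun _ _ => rfl)
    simpa only [hω.ips_init, hω'.ips_init] using this
  obtain ⟨Φ₁, hΦ₁, hY'⟩ : ∃ Φ : (Finset.range k → Finset (Fin N)) × (Fin N → E d) →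
      (Fin N → E d), Measurable Φ ∧
        ∀ ω ∈ good, (fun i => Y i (k * κ) ω) = Φ (J ω, fun i => X₀ i ω) := by
    refine exists_measurable_factor (c := √(N * Real.exp (L * N * (k * κ))))
      fun ω hω ω' hω' hJJ => ?_
    -- Up to time `k * κ`, excluded, only batches with index below `k` are active.
    have := hω.rbm.dist_le hω'.rbm h hp hω.card (τ := k * κ) (by positivity) fun r hr => by
      have hlt : ⌊r / κ⌋₊ < k := by
        rw [Nat.floor_lt (div_nonneg hr.1 hκ.le), div_lt_iff₀ hκ]
        exact hr.2
      exact congrFun hJJ ⟨_, Finset.mem_range.2 hlt⟩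
    simpa only [hω.rbm_init, hω'.rbm_init] using this
  obtain ⟨Φ₂, hΦ₂, hs'⟩ := hXfac s hs
  obtain ⟨Φ₃, hΦ₃, ht'⟩ := hXfac t ht
  have hind := (hC.indepFun_past hX₀ k).comp (φ := id)
    (ψ := fun u => (u.2, Φ₁ u, Φ₂ u, Φ₃ u)) measurable_id (by fun_prop)
  refine hind.congr (Filter.EventuallyEq.refl _ _) ?_
  filter_upwards [ae_isCoupledPath hpN hC hX hY] with ω hω
  simp only [Function.comp_apply]
  rw [← hY' ω hω, ← hs' ω hω, ← ht' ω hω]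

end Coupling

end RBM

namespace RBM

/-! ### Mean square error over one time step -/

section Coupling

variable {d N p : ℕ} {lam : ℝ} {L : ℝ≥0} {B A q M κ : ℝ} {V : E d → ℝ} {K : E d → E d}
  {Ω : Type*} [MeasurableSpace Ω] {P : Measure Ω} [IsProbabilityMeasure P]
  {X₀ : Fin N → Ω → E d} {𝒞 : ℕ → Ω → Finset (Fin N)} {X Y : Fin N → ℝ → Ω → E d}

theorem IsCoupledPath.norm_rbm_le {S : ℕ → Finset (Fin N)} {x₀ : Fin N → E d}
    {x y : Fin N → ℝ → E d} (hω : IsCoupledPath V K p κ S x₀ x y)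
    (h : Admissible lam L B A q V K) (hq : 0 < q) (hp : 2 ≤ p) (i : Fin N) {t : ℝ}
    (ht : 0 ≤ t) : ‖y i t‖ ≤ pathBound lam B A q ‖x₀ i‖ := by
  have := hω.rbm.norm_le h hq hp hω.card i ht
  rw [hω.rbm_init] at this
  exact h.norm_le_pathBound hq this

theorem IsCoupledPath.norm_ips_le {S : ℕ → Finset (Fin N)} {x₀ : Fin N → E d}
    {x y : Fin N → ℝ → E d} (hω : IsCoupledPath V K p κ S x₀ x y)
    (h : Admissible lam L B A q V K) (hq : 0 < q) (hN : 2 ≤ N) (i : Fin N) {t : ℝ}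
    (ht : 0 ≤ t) : ‖x i t‖ ≤ pathBound lam B A q ‖x₀ i‖ := by
  have := hω.ips.norm_le h hq hN (fun _ => by simp) i ht
  rw [hω.ips_init] at this
  exact h.norm_le_pathBound hq this

/-- Evolution over a time step of the mean square distance of the coupled processes. -/
theorem integral_sq_norm_sub_step_le (h : Admissible lam L B A q V K) (hq : 0 < q) (hp : 2 ≤ p)
    (hpN : p ≤ N) (hκ : 0 < κ) (hX₀ : ∀ i, Measurable (X₀ i))
    (hM : ∀ i, ∫⁻ ω, ‖X₀ i ω‖ₑ ^ (2 * q) ∂P ≤ ENNReal.ofReal M)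
    (hC : IsBatchSequence P p X₀ 𝒞) (hX : IsIPS P V K X₀ X) (hY : IsRBMr P V K p κ X₀ 𝒞 Y)
    {θ : ℝ} (hθ : θ = p / N) (k : ℕ) {U : ℝ}
    (hU : ∀ i, ∫ ω, ‖Y i (k * κ) ω - X i (θ * (k * κ)) ω‖ ^ 2 ∂P ≤ U) (i : Fin N) :
    ∫ ω, ‖Y i ((k + 1) * κ) ω - X i (θ * ((k + 1) * κ)) ω‖ ^ 2 ∂P ≤
      (1 - κ * ((2 * lam - 3 * L) * θ)) * ∫ ω, ‖Y i (k * κ) ω - X i (θ * (k * κ)) ω‖ ^ 2 ∂P +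
        κ * (L * θ * U) + κ ^ 2 * ((16 * lam + 8) * pathMoment lam B A q M) := by
  have hN : 2 ≤ N := hp.trans hpN
  have hN0 : (0 : ℝ) < N := by exact_mod_cast (by lia : 0 < N)
  have hp0 : (0 : ℝ) < p := by exact_mod_cast (by lia : 0 < p)
  have hθ0 : 0 < θ := hθ ▸ div_pos hp0 hN0
  have hθ1 : θ ≤ 1 := hθ ▸ (div_le_one hN0).2 (by exact_mod_cast hpN)
  have hL := L.coe_nonneg
  have hgt := h.lam_gt
  have ht₀ : 0 ≤ (k : ℝ) * κ := by positivity
  have ht₁ : 0 ≤ ((k : ℝ) + 1) * κ := by positivity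
  have hs₀ : 0 ≤ θ * ((k : ℝ) * κ) := by positivity
  have hs₁ : 0 ≤ θ * (((k : ℝ) + 1) * κ) := by positivity
  set t₀ : ℝ := (k : ℝ) * κ with ht₀_def
  set t₁ : ℝ := ((k : ℝ) + 1) * κ with ht₁_def
  set G := pathMoment lam B A q M with hG
  set Γ : Fin N → Ω → ℝ := fun j ω => pathBound lam B A q ‖X₀ j ω‖ with hΓ
  set b : Fin N → ℝ := fun j => batchWeight N Finset.univ i j with hb
  have hb0 : ∀ j, 0 ≤ b j := fun j => batchWeight_nonneg hN _ _ _
  have hb1 : ∑ j, b j = 1 := by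
    simp only [hb]
    rw [sum_batchWeight hN (by simp)]; simp [activity]
  have hgood := ae_isCoupledPath hpN hC hX hY
  have hind := indepFun_state h hp hpN hκ hX₀ hC hX hY k hs₀ hs₁
  rw [← ht₀_def] at hind
  have hΓint : ∀ j, Integrable (fun ω => Γ j ω ^ 2) P := fun j =>
    (integrable_pathBound_sq_and_integral_le hq (hX₀ j) (hM j)).1
  have hΓle : ∀ j, ∫ ω, Γ j ω ^ 2 ∂P ≤ G := fun j =>
    (integrable_pathBound_sq_and_integral_le hq (hX₀ j) (hM j)).2
  have hmY : ∀ j, ∀ t ≥ 0, Measurable (Y j t) := hY.measurable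
  have hmX : ∀ j, ∀ t ≥ 0, Measurable (X j t) := hX.measurable
  have hKm : Measurable K := h.lipschitz.continuous.measurable
  have hDΓ : ∀ t ≥ 0, ∀ᵐ ω ∂P, ∀ j, ‖Y j t ω - X j (θ * t) ω‖ ≤ 2 * Γ j ω := by
    intro t ht
    filter_upwards [hgood] with ω hω j
    linarith [norm_sub_le (Y j t ω) (X j (θ * t) ω), hω.norm_rbm_le h hq hp j ht,
      hω.norm_ips_le h hq hN j (mul_nonneg hθ0.le ht)]
  have hDint : ∀ t ≥ 0, ∀ j, Integrable (fun ω => ‖Y j t ω - X j (θ * t) ω‖ ^ 2) P := by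
    intro t ht j
    refine ((hΓint j).const_mul 4).mono' ((((hmY j t ht).sub
      (hmX j _ (mul_nonneg hθ0.le ht))).norm).pow_const 2).aestronglyMeasurable ?_
    filter_upwards [hDΓ t ht] with ω hω
    rw [Real.norm_of_nonneg (sq_nonneg _)]
    nlinarith [hω j, norm_nonneg (Y j t ω - X j (θ * t) ω)]
  set u : Fin N → ℝ := fun j => ∫ ω, ‖Y j t₀ ω - X j (θ * t₀) ω‖ ^ 2 ∂P with hu
  set g : Fin N → ℝ := fun j => ∫ ω, Γ j ω ^ 2 ∂P with hg
  have hDmean : ∀ j, HasMean P (fun ω => ‖Y j t₀ ω - X j (θ * t₀) ω‖ ^ 2) (u j) :=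
    fun j => (hDint t₀ ht₀ j).hasMean
  have hΓmean : ∀ j, HasMean P (fun ω => Γ j ω ^ 2) (g j) := fun j => (hΓint j).hasMean
  have hact : HasMean P (fun ω => activity (𝒞 k ω) i) θ :=
    ⟨hC.integrable_comp k fun S => activity S i, by rw [hC.integral_activity hpN, hθ]⟩
  have hwt : ∀ j, HasMean P (fun ω => batchWeight p (𝒞 k ω) i j) (θ * b j) := fun j =>
    ⟨hC.integrable_comp k fun S => batchWeight p S i j, by
      rw [hC.integral_batchWeight hp hpN, hθ]⟩
  -- the two terms of mean zero
  have hI₁ : Integrable (fun ω => inner ℝ (Y i t₀ ω - X i (θ * t₀) ω)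
      (X i (θ * t₁) ω - X i (θ * t₀) ω)) P := by
    refine ((hΓint i).const_mul 4).mono' (((hmY i t₀ ht₀).sub (hmX i _ hs₀)).inner
      ((hmX i _ hs₁).sub (hmX i _ hs₀))).aestronglyMeasurable ?_
    filter_upwards [hDΓ t₀ ht₀, hgood] with ω hω hω'
    refine (abs_real_inner_le_norm _ _).trans ?_
    have h1 := norm_sub_le (X i (θ * t₁) ω) (X i (θ * t₀) ω)
    have h2 := hω'.norm_ips_le h hq hN i hs₁
    have h3 := hω'.norm_ips_le h hq hN i hs₀
    have h4 : ‖X i (θ * t₁) ω - X i (θ * t₀) ω‖ ≤ 2 * Γ i ω := by linarith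
    refine (mul_le_mul (hω i) h4 (norm_nonneg _) ((norm_nonneg _).trans (hω i))).trans_eq ?_
    ring
  have hI₂ : ∀ j, Integrable (fun ω => inner ℝ (Y i t₀ ω - X i (θ * t₀) ω)
      (K (X j (θ * t₀) ω - X i (θ * t₀) ω))) P := by
    intro j
    refine ((hΓint i).add (integrable_const (B ^ 2))).mono'
      (((hmY i t₀ ht₀).sub (hmX i _ hs₀)).inner
      (hKm.comp ((hmX j _ hs₀).sub (hmX i _ hs₀)))).aestronglyMeasurable ?_
    filter_upwards [hDΓ t₀ ht₀] with ω hω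
    refine (abs_real_inner_le_norm _ _).trans ?_
    refine (mul_le_mul (hω i) (h.bounded _) (norm_nonneg _)
      ((norm_nonneg _).trans (hω i))).trans ?_
    simp only [Pi.add_apply]
    nlinarith [sq_nonneg (Γ i ω - B)]
  have hZ₁ : HasMean P (fun ω => (activity (𝒞 k ω) i / θ - 1) *
      inner ℝ (Y i t₀ ω - X i (θ * t₀) ω) (X i (θ * t₁) ω - X i (θ * t₀) ω)) 0 := by
    have h0 : HasMean P (fun ω => activity (𝒞 k ω) i / θ - 1) 0 := by
      refine ⟨hC.integrable_comp k fun S => activity S i / θ - 1, ?_⟩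
      rw [integral_sub (hact.1.div_const θ) (integrable_const _), integral_div, hact.2,
        div_self hθ0.ne']
      simp
    -- The increment reaches to the end of the step, yet it is independent of `𝒞 k`, since the full
    -- system does not see the batches.
    have := HasMean.mul_of_indepFun hind (φ := fun S => activity S i / θ - 1)
      (ψ := fun s => inner ℝ (s.2.1 i - s.2.2.1 i) (s.2.2.2 i - s.2.2.1 i))
      (measurable_of_finite _) (by fun_prop) h0 hI₁.hasMean
    rwa [zero_mul] at this
  have hZ₂ : ∀ j, HasMean P (fun ω => (batchWeight p (𝒞 k ω) i j - activity (𝒞 k ω) i * b j) *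
      inner ℝ (Y i t₀ ω - X i (θ * t₀) ω) (K (X j (θ * t₀) ω - X i (θ * t₀) ω))) 0 := by
    intro j
    have h0 : HasMean P (fun ω => batchWeight p (𝒞 k ω) i j - activity (𝒞 k ω) i * b j) 0 := by
      refine ⟨hC.integrable_comp k fun S => batchWeight p S i j - activity S i * b j, ?_⟩
      rw [integral_sub (hwt j).1 (hact.1.mul_const _), integral_mul_const, hact.2, (hwt j).2,
        sub_self]
    have := HasMean.mul_of_indepFun hind
      (φ := fun S => batchWeight p S i j - activity S i * b j)
      (ψ := fun s => inner ℝ (s.2.1 i - s.2.2.1 i) (K (s.2.2.1 j - s.2.2.1 i)))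
      (measurable_of_finite _) (by fun_prop) h0 (hI₂ j).hasMean
    rwa [zero_mul] at this
  have hA : HasMean P (fun ω => activity (𝒞 k ω) i * ‖Y i t₀ ω - X i (θ * t₀) ω‖ ^ 2)
      (θ * u i) :=
    HasMean.mul_of_indepFun hind (φ := fun S => activity S i)
      (ψ := fun s => ‖s.2.1 i - s.2.2.1 i‖ ^ 2) (measurable_of_finite _) (by fun_prop) hact
      (hDmean i)
  have hW : ∀ j, HasMean P (fun ω => batchWeight p (𝒞 k ω) i j *
      ‖Y j t₀ ω - X j (θ * t₀) ω‖ ^ 2) (θ * b j * u j) := fun j =>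
    HasMean.mul_of_indepFun hind (φ := fun S => batchWeight p S i j)
      (ψ := fun s => ‖s.2.1 j - s.2.2.1 j‖ ^ 2) (measurable_of_finite _) (by fun_prop) (hwt j)
      (hDmean j)
  have hWΓ : ∀ j, HasMean P (fun ω => batchWeight p (𝒞 k ω) i j * Γ j ω ^ 2)
      (θ * b j * g j) := fun j =>
    HasMean.mul_of_indepFun hind (φ := fun S => batchWeight p S i j)
      (ψ := fun s => pathBound lam B A q ‖s.1 j‖ ^ 2) (measurable_of_finite _)
      (by unfold pathBound; fun_prop) (hwt j) (hΓmean j)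
  have hrhs := ((((hDmean i).add (hZ₁.const_mul 2)).add
    ((HasMean.sum (s := Finset.univ) fun j _ => hZ₂ j).const_mul (2 * κ))).add
    (((hA.const_mul (-(2 * lam - 3 * L))).add
      ((HasMean.sum (s := Finset.univ) fun j _ => hW j).const_mul (L : ℝ))).const_mul κ)).add
    (((((hΓmean i).const_mul (16 * lam - 12 * L + 8)).add
      ((HasMean.sum (s := Finset.univ) fun j _ => hWΓ j).const_mul (10 * (L : ℝ)))).add
      ((HasMean.sum (s := Finset.univ) fun j _ =>
        (hΓmean j).const_mul (b j)).const_mul (2 * (L : ℝ)))).const_mul (κ ^ 2))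
  have hle := ((hDint t₁ ht₁ i).hasMean).le hrhs (by
    filter_upwards [hgood] with ω hω
    refine (hω.rbm.sq_norm_sub_step_le hω.ips h hq hp hpN hκ hω.card
      (fun j => (hω.rbm_init j).trans (hω.ips_init j).symm) k i hθ
      (Γ := fun j => Γ j ω) (fun j => by rw [hω.ips_init j])
      (z := fun j s => X j (θ * s) ω) (fun _ _ => rfl)).trans_eq ?_
    simp only [hb]
    ring)
  have hs1 : ∑ j, θ * b j * u j ≤ θ * U := by
    calc ∑ j, θ * b j * u j ≤ ∑ j, θ * b j * U := Finset.sum_le_sum fun j _ =>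
          mul_le_mul_of_nonneg_left (hU j) (mul_nonneg hθ0.le (hb0 j))
      _ = θ * U := by rw [← Finset.sum_mul, ← Finset.mul_sum, hb1, mul_one]
  have hg0 : ∀ j, 0 ≤ g j := fun j => integral_nonneg fun ω => sq_nonneg _
  have hs3 : ∑ j, b j * g j ≤ G := by
    calc ∑ j, b j * g j ≤ ∑ j, b j * G := Finset.sum_le_sum fun j _ =>
          mul_le_mul_of_nonneg_left (hΓle j) (hb0 j)
      _ = G := by rw [← Finset.sum_mul, hb1, one_mul]
  have hs2 : ∑ j, θ * b j * g j ≤ G := by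
    refine le_trans (Finset.sum_le_sum fun j _ => ?_) hs3
    rw [mul_assoc]
    exact mul_le_of_le_one_left (mul_nonneg (hb0 j) (hg0 j)) hθ1
  have e1 : κ * (L * ∑ j, θ * b j * u j) ≤ κ * (L * (θ * U)) := by gcongr
  have e2 : (16 * lam - 12 * L + 8) * g i + 10 * L * ∑ j, θ * b j * g j +
      -- The multiples of `L` cancel: `-12 + 10 + 2 = 0`.
      2 * L * ∑ j, b j * g j ≤ (16 * lam + 8) * G := by
    have h1 := mul_le_mul_of_nonneg_left (hΓle i) (by linarith : 0 ≤ 16 * lam - 12 * L + 8)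
    have h2 := mul_le_mul_of_nonneg_left hs2 (by positivity : 0 ≤ 10 * (L : ℝ))
    have h3 := mul_le_mul_of_nonneg_left hs3 (by positivity : 0 ≤ 2 * (L : ℝ))
    linarith
  have e3 := mul_le_mul_of_nonneg_left e2 (sq_nonneg κ)
  simp only [mul_zero, Finset.sum_const_zero, add_zero] at hle
  linarith

end Coupling

end RBM

namespace RBM

/-- Any coupling bounds the Wasserstein distance. -/
theorem W2_map_le {d : ℕ} {Ω : Type*} [MeasurableSpace Ω] {P : Measure Ω} {Y X : Ω → E d}
    (hY : Measurable Y) (hX : Measurable X) :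
    W2 (P.map Y) (P.map X) ≤ (∫⁻ ω, edist (Y ω) (X ω) ^ 2 ∂P) ^ (1 / 2 : ℝ) := by
  refine ENNReal.rpow_le_rpow ?_ (by norm_num)
  have hmem : P.map (fun ω => (Y ω, X ω)) ∈ {γ : Measure (E d × E d) |
      γ.map Prod.fst = P.map Y ∧ γ.map Prod.snd = P.map X} := by
    constructor
    · rw [Measure.map_map measurable_fst (by fun_prop)]; rfl
    · rw [Measure.map_map measurable_snd (by fun_prop)]; rfl
  refine (iInf₂_le _ hmem).trans_eq ?_
  rw [lintegral_map (by fun_prop) (by fun_prop)]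

/-! ### Uniform in time error bounds -/

section Coupling

variable {d N p : ℕ} {lam : ℝ} {L : ℝ≥0} {B A q M κ : ℝ} {V : E d → ℝ} {K : E d → E d}
  {Ω : Type*} [MeasurableSpace Ω] {P : Measure Ω} [IsProbabilityMeasure P]
  {X₀ : Fin N → Ω → E d} {𝒞 : ℕ → Ω → Finset (Fin N)} {X Y : Fin N → ℝ → Ω → E d}

/-- Uniform in time bound for the mean square distance of the coupled processes at the times at
which the batches are drawn. -/
theorem integral_sq_norm_sub_le (h : Admissible lam L B A q V K) (hq : 0 < q) (hp : 2 ≤ p)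
    (hpN : p ≤ N) (hκ : 0 < κ) (hκ' : κ * (2 * lam - 3 * L) ≤ 1) (hX₀ : ∀ i, Measurable (X₀ i))
    (hM : ∀ i, ∫⁻ ω, ‖X₀ i ω‖ₑ ^ (2 * q) ∂P ≤ ENNReal.ofReal M)
    (hC : IsBatchSequence P p X₀ 𝒞) (hX : IsIPS P V K X₀ X) (hY : IsRBMr P V K p κ X₀ 𝒞 Y)
    {θ : ℝ} (hθ : θ = p / N) (k : ℕ) (i : Fin N) :
    ∫ ω, ‖Y i (k * κ) ω - X i (θ * (k * κ)) ω‖ ^ 2 ∂P ≤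
      κ * ((16 * lam + 8) * pathMoment lam B A q M / (2 * θ * (lam - 2 * L))) := by
  have hN0 : (0 : ℝ) < N := by exact_mod_cast (by lia : 0 < N)
  have hp0 : (0 : ℝ) < p := by exact_mod_cast (by lia : 0 < p)
  have hθ0 : 0 < θ := hθ ▸ div_pos hp0 hN0
  have hθ1 : θ ≤ 1 := hθ ▸ (div_le_one hN0).2 (by exact_mod_cast hpN)
  have hL := L.coe_nonneg
  have hgt := h.lam_gt
  have hμ : 0 < lam - 2 * L := by linarith
  have hG := pathMoment_nonneg lam B A q M
  have hlam := h.lam_pos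
  induction k generalizing i with
  | zero =>
    have : (fun ω => ‖Y i ((0 : ℕ) * κ) ω - X i (θ * ((0 : ℕ) * κ)) ω‖ ^ 2) =ᵐ[P] 0 := by
      filter_upwards [hX.init, hY.init] with ω h1 h2
      simp [h1 i, h2 i]
    rw [integral_congr_ae this]
    simp only [Pi.zero_apply, integral_zero]
    positivity
  | succ k ih =>
    have hstep := integral_sq_norm_sub_step_le h hq hp hpN hκ hX₀ hM hC hX hY hθ k ih i
    push_cast
    refine hstep.trans ?_
    -- The smallness of `κ` enters here: the induction hypothesis is multiplied by this factor.
    have hc : 0 ≤ 1 - κ * ((2 * lam - 3 * L) * θ) := by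
      have h1 : 0 ≤ κ * (2 * lam - 3 * L) := mul_nonneg hκ.le (by linarith)
      have := mul_le_of_le_one_right h1 hθ1
      linarith
    have h1 := mul_le_mul_of_nonneg_left (ih i) hc
    -- The claimed bound is the fixed point of the recursion, where the net rate is `(2λ - 3L)θ - Lθ
    -- = 2θ(λ - 2L)`.
    refine (add_le_add_left (add_le_add_left h1 _) _).trans_eq ?_
    field_simp
    ring

/-- Bound for the mean square distance of the coupled processes at an arbitrary time. -/
theorem lintegral_edist_sq_le (h : Admissible lam L B A q V K) (hq : 0 < q) (hp : 2 ≤ p)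
    (hpN : p ≤ N) (hκ : 0 < κ) (hκ' : κ * (2 * lam - 3 * L) ≤ 1) (hX₀ : ∀ i, Measurable (X₀ i))
    (hM : ∀ i, ∫⁻ ω, ‖X₀ i ω‖ₑ ^ (2 * q) ∂P ≤ ENNReal.ofReal M)
    (hC : IsBatchSequence P p X₀ 𝒞) (hX : IsIPS P V K X₀ X) (hY : IsRBMr P V K p κ X₀ 𝒞 Y)
    {θ : ℝ} (hθ : θ = p / N) {s : ℝ} (hs : 0 ≤ s) (i : Fin N) :
    ∫⁻ ω, edist (Y i s ω) (X i (θ * s) ω) ^ 2 ∂P ≤ ENNReal.ofReal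
      (2 * (κ * ((16 * lam + 8) * pathMoment lam B A q M / (2 * θ * (lam - 2 * L)))) +
        8 * κ ^ 2 * pathMoment lam B A q M) := by
  have hN : 2 ≤ N := hp.trans hpN
  have hN0 : (0 : ℝ) < N := by exact_mod_cast (by lia : 0 < N)
  have hp0 : (0 : ℝ) < p := by exact_mod_cast (by lia : 0 < p)
  have hθ0 : 0 < θ := hθ ▸ div_pos hp0 hN0
  have hθ1 : θ ≤ 1 := hθ ▸ (div_le_one hN0).2 (by exact_mod_cast hpN)
  set k := ⌊s / κ⌋₊ with hk
  have hks : k * κ ≤ s := (le_div_iff₀ hκ).1 (Nat.floor_le (div_nonneg hs hκ.le))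
  have hsk : s - k * κ ≤ κ := by
    have := (div_lt_iff₀ hκ).1 (Nat.lt_floor_add_one (s / κ))
    rw [← hk] at this
    linarith
  have hk0 : 0 ≤ (k : ℝ) * κ := by positivity
  obtain ⟨hΓint, hΓle⟩ :=
    integrable_pathBound_sq_and_integral_le (lam := lam) (B := B) (A := A) hq (hX₀ i) (hM i)
  have hgood := ae_isCoupledPath hpN hC hX hY
  have hmean := integral_sq_norm_sub_le h hq hp hpN hκ hκ' hX₀ hM hC hX hY hθ k i
  have hint : Integrable (fun ω => ‖Y i (k * κ) ω - X i (θ * (k * κ)) ω‖ ^ 2) P := by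
    refine (hΓint.const_mul 4).mono' ((((hY.measurable i _ hk0).sub
      (hX.measurable i _ (mul_nonneg hθ0.le hk0))).norm).pow_const 2).aestronglyMeasurable ?_
    filter_upwards [hgood] with ω hω
    rw [Real.norm_of_nonneg (sq_nonneg _)]
    have h1 := norm_sub_le (Y i (k * κ) ω) (X i (θ * (k * κ)) ω)
    have h2 := hω.norm_rbm_le h hq hp i hk0
    have h3 := hω.norm_ips_le h hq hN i (mul_nonneg hθ0.le hk0)
    nlinarith [norm_nonneg (Y i (k * κ) ω - X i (θ * (k * κ)) ω)]
  have hpt : ∀ᵐ ω ∂P, edist (Y i s ω) (X i (θ * s) ω) ^ 2 ≤ ENNReal.ofReal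
      (2 * ‖Y i (k * κ) ω - X i (θ * (k * κ)) ω‖ ^ 2 +
        8 * κ ^ 2 * pathBound lam B A q ‖X₀ i ω‖ ^ 2) := by
    filter_upwards [hgood] with ω hω
    rw [edist_dist, ← ENNReal.ofReal_pow dist_nonneg, dist_eq_norm]
    refine ENNReal.ofReal_le_ofReal ?_
    have hΓ0 := (norm_nonneg _).trans (hω.norm_rbm_le h hq hp i hs)
    have h1 := hω.rbm.norm_sub_le h hq hp hω.card i hk0 hks
    have h2 := hω.ips.norm_sub_le h hq hN (fun _ => by simp) i (mul_nonneg hθ0.le hk0)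
      (mul_le_mul_of_nonneg_left hks hθ0.le)
    simp only [hω.rbm_init, hω.ips_init, ← mul_sub] at h1 h2
    have h3 : (s - k * κ) * pathBound lam B A q ‖X₀ i ω‖ ≤
        κ * pathBound lam B A q ‖X₀ i ω‖ := mul_le_mul_of_nonneg_right hsk hΓ0
    have h4 : θ * (s - k * κ) * pathBound lam B A q ‖X₀ i ω‖ ≤
        κ * pathBound lam B A q ‖X₀ i ω‖ :=
      mul_le_mul_of_nonneg_right
        ((mul_le_of_le_one_left (by linarith) hθ1).trans hsk) hΓ0
    -- Since the last batch was drawn each process has moved by at most `κ` times `pathBound`.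
    have e : Y i s ω - X i (θ * s) ω = (Y i (k * κ) ω - X i (θ * (k * κ)) ω) +
        ((Y i s ω - Y i (k * κ) ω) - (X i (θ * s) ω - X i (θ * (k * κ)) ω)) := by abel
    have h5 := norm_add_le (Y i (k * κ) ω - X i (θ * (k * κ)) ω)
      ((Y i s ω - Y i (k * κ) ω) - (X i (θ * s) ω - X i (θ * (k * κ)) ω))
    have h6 := norm_sub_le (Y i s ω - Y i (k * κ) ω) (X i (θ * s) ω - X i (θ * (k * κ)) ω)
    rw [← e] at h5
    have h7 : ‖Y i s ω - X i (θ * s) ω‖ ≤ ‖Y i (k * κ) ω - X i (θ * (k * κ)) ω‖ +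
        2 * (κ * pathBound lam B A q ‖X₀ i ω‖) := by linarith
    refine (pow_le_pow_left₀ (norm_nonneg _) h7 2).trans ?_
    nlinarith [sq_nonneg (‖Y i (k * κ) ω - X i (θ * (k * κ)) ω‖ -
      2 * (κ * pathBound lam B A q ‖X₀ i ω‖))]
  refine (lintegral_mono_ae hpt).trans ?_
  have hint' : Integrable (fun ω => 2 * ‖Y i (k * κ) ω - X i (θ * (k * κ)) ω‖ ^ 2 +
      8 * κ ^ 2 * pathBound lam B A q ‖X₀ i ω‖ ^ 2) P :=
    (hint.const_mul 2).add (hΓint.const_mul _)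
  rw [← ofReal_integral_eq_lintegral_ofReal hint'
    (Filter.Eventually.of_forall fun ω => by positivity)]
  refine ENNReal.ofReal_le_ofReal ?_
  rw [integral_add (hint.const_mul 2) (hΓint.const_mul _), integral_const_mul,
    integral_const_mul]
  have h1 := mul_le_mul_of_nonneg_left hΓle (by positivity : 0 ≤ 8 * κ ^ 2)
  linarith

end Coupling

end RBM

/-! ### Conclusion -/

theorem theorem2p2 (d : ℕ) (lam : ℝ) (L : ℝ≥0) (B A q M : ℝ) (hq : 0 < q) :
    ∃ C > 0, ∀ (V : RBM.E d → ℝ) (K : RBM.E d → RBM.E d), RBM.Admissible lam L B A q V K →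
      ∀ T > 0, ∀ N p : ℕ, 2 ≤ p → p ≤ N →
        ∃ κ₀ > 0, ∀ κ : ℝ, 0 < κ → κ < κ₀ →
          ∀ {Ω : Type*} [MeasurableSpace Ω] (P : Measure Ω) [IsProbabilityMeasure P]
            (X₀ : Fin N → Ω → RBM.E d) (𝒞 : ℕ → Ω → Finset (Fin N))
            (X Y : Fin N → ℝ → Ω → RBM.E d),
            (∀ i, Measurable (X₀ i)) →
            (∀ i, ∫⁻ ω, ‖X₀ i ω‖ₑ ^ (2 * q) ∂P ≤ ENNReal.ofReal M) →
            RBM.IsBatchSequence P p X₀ 𝒞 →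
            RBM.IsIPS P V K X₀ X →
            RBM.IsRBMr P V K p κ X₀ 𝒞 Y →
            ∀ i, ⨆ t ∈ Set.Icc (0 : ℝ) T,
                RBM.W2 (P.map (Y i ((N : ℝ) / p * t))) (P.map (X i t)) ≤
              ENNReal.ofReal
                (C * Real.sqrt (1 + T) * ((N : ℝ) / p) ^ (3 / 4 : ℝ) * κ ^ (1 / 2 : ℝ)) := by
  set G := RBM.pathMoment lam B A q M with hG
  set c := (16 * lam + 8) * G / (lam - 2 * L) + 8 * G with hc
  -- The constant is chosen before admissibility is known, when `c` may be negative; adding one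
  -- keeps it positive.
  refine ⟨√c + 1, by positivity, fun V K h T hT N p hp hpN => ?_⟩
  have hG0 : 0 ≤ G := RBM.pathMoment_nonneg lam B A q M
  have hlam := h.lam_pos
  have hgt := h.lam_gt
  have hL := L.coe_nonneg
  have hμ : 0 < lam - 2 * L := by linarith
  have hν : 0 < 2 * lam - 3 * L := by linarith
  have hN0 : (0 : ℝ) < N := by exact_mod_cast (by lia : 0 < N)
  have hp0 : (0 : ℝ) < p := by exact_mod_cast (by lia : 0 < p)
  set r : ℝ := (N : ℝ) / p with hr
  have hr1 : 1 ≤ r := (one_le_div hp0).2 (by exact_mod_cast hpN)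
  have hr0 : 0 < r := by linarith
  -- The bound `1` lets `κ²` be absorbed into `r * κ`; the other keeps the factor of the recursion
  -- nonnegative.
  refine ⟨min 1 (1 / (2 * lam - 3 * L)), lt_min one_pos (one_div_pos.2 hν),
    fun κ hκ hκ₀ Ω _ P _ X₀ 𝒞 X Y hX₀ hM hC hX hY i => iSup₂_le fun t ht => ?_⟩
  have hκ1 : κ ≤ 1 := (hκ₀.trans_le (min_le_left _ _)).le
  have hκ2 : κ * (2 * lam - 3 * L) ≤ 1 :=
    (le_div_iff₀ hν).1 (hκ₀.trans_le (min_le_right _ _)).le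
  have hrt : 0 ≤ r * t := mul_nonneg hr0.le ht.1
  have hθ : r⁻¹ = (p : ℝ) / N := by rw [hr, inv_div]
  have key := RBM.lintegral_edist_sq_le h hq hp hpN hκ hκ2 hX₀ hM hC hX hY hθ hrt i
  rw [inv_mul_cancel_left₀ hr0.ne'] at key
  refine (RBM.W2_map_le (hY.measurable i _ hrt) (hX.measurable i t ht.1)).trans ?_
  refine (ENNReal.rpow_le_rpow key (by norm_num)).trans ?_
  rw [← hG, ENNReal.ofReal_rpow_of_nonneg (by positivity) (by norm_num)]
  refine ENNReal.ofReal_le_ofReal ?_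
  have hc0 : 0 ≤ c := by positivity
  have h1 : 2 * (κ * ((16 * lam + 8) * G / (2 * r⁻¹ * (lam - 2 * L)))) + 8 * κ ^ 2 * G ≤
      c * (r * κ) := by
    have e : 2 * (κ * ((16 * lam + 8) * G / (2 * r⁻¹ * (lam - 2 * L)))) =
        (16 * lam + 8) * G / (lam - 2 * L) * (r * κ) := by
      field_simp
    rw [e, hc, add_mul]
    have h2 : κ * κ ≤ r * κ := mul_le_mul_of_nonneg_right (hκ1.trans hr1) hκ.le
    have := mul_le_mul_of_nonneg_left h2 (by positivity : 0 ≤ 8 * G)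
    linarith
  refine (Real.rpow_le_rpow (by positivity) h1 (by norm_num)).trans ?_
  rw [Real.mul_rpow hc0 (by positivity), Real.mul_rpow hr0.le hκ.le, ← mul_assoc,
    ← Real.sqrt_eq_rpow c]
  refine mul_le_mul_of_nonneg_right ?_ (by positivity)
  -- The bound obtained has exponent `1 / 2` on `r` and no growth in `T`; both are weakened to the
  -- stated form.
  refine mul_le_mul ?_ (Real.rpow_le_rpow_of_exponent_le hr1 (by norm_num)) (by positivity)
    (by positivity)
  have h3 : 1 ≤ √(1 + T) := Real.one_le_sqrt.2 (by linarith)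
  calc √c ≤ √c + 1 := by linarith
    _ ≤ (√c + 1) * √(1 + T) := le_mul_of_one_le_right (by positivity) h3
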